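/- **Surface and geodesics.** For $0<b<1$, the 2-square-$b$ surface consists of two closed unit squares, $\mathrm{LS}(b)$ (left) and $\mathrm{RS}(b)$ (right). The top edge of each square is identified with its bottom edge. Points of each square are written in coordinates measured from its lower left vertex. The point $(1,y)$ of the right edge of either square is identified with the point $(0,y)$ of the left edge of the *other* square if $0\le y\le b$ (the gate), and with the point $(0,y)$ of the left edge of the *same* square if $b\le y\le 1$ (the barrier). An $\alpha$-geodesic is a half-infinite curve $\mathcal L(t)$, $t\ge 0$, that moves on the surface with unit speed along straight lines in the direction $(1,\alpha)$ and never hits a singularity of the surface (a vertex of the squares or an endpoint of a gate). $|\cdot|$ applied to a set of times is Lebesgue measure. **Theorem 3.4.** Let $0<\varepsilon<1$ and let $\alpha\in(0,1)$ be an irrational number with continued fraction $\alpha=[a_1,a_2,a_3,\ldots]=\cfrac{1}{a_1+\cfrac{1}{a_2+\cdots}}$ such that $$\sum_{i=1}^\infty\frac1{a_i}<\frac{\varepsilon}{300}.$$ Let $p_i/q_i$ ($i\ge0$, $p_0/q_0=0/1$) be the convergents of $\alpha$, and let $\eta_i=q_i\alpha-p_i$. Define the gate size $\beta_0=\beta_0(\alpha)$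 and the height $y_0=y_0(\alpha)$ by $$\beta_0=\sum_{i\ \mathrm{even}}2\eta_i-\sum_{i\ \mathrm{odd}}2\eta_i,\qquad y_0=1-\sum_{i\ \mathrm{even}}2\eta_i-\sum_{i\ \mathrm{odd}}3\eta_i .$$ Then $0<\beta_0<1$, and there is an $\alpha$-geodesic $\mathcal L_0$ on the 2-square-$\beta_0$ surface that starts from the point at height $y_0$ of the left edge of the left square and has the following two properties. (i) There is an infinite sequence of positive real numbers $T^*_n$, $n=1,2,3,\ldots$, with $T^*_{n+1}>2T^*_n$, such that for every $n\ge1$, every positive integer $C<200/\varepsilon$ and every integer $b\in\{0,1,\ldots,C\}$ with $b\neq1$, $$\frac1{T^*_n}\bigl|\{t\in[bT^*_n,(b+1)T^*_n]:\mathcal L_0(t)\in \mathrm{LS}(\beta_0)\}\bigr|>1-\varepsilon,$$ and for every $n\ge1$ $$\frac1{T^*_n}\bigl|\{t\in[T^*_n,2T^*_n]:\mathcal L_0(t)\in \mathrm{RS}(\beta_0)\}\bigr|>1-\varepsilon.$$ (ii) There is an infinite sequence of positive real numbers $T^{**}_n$, $n=1,2,3,\ldots$, with $T^{**}_{n+1}>2T^{**}_n$,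 such that for every $n\ge1$, every positive integer $C<200/\varepsilon$ and every integer $b\in\{0,1,\ldots,C\}$ with $b\neq2$, $$\frac1{T^{**}_n}\bigl|\{t\in[bT^{**}_n,(b+1)T^{**}_n]:\mathcal L_0(t)\in \mathrm{LS}(\beta_0)\}\bigr|>1-\varepsilon,$$ and for every $n\ge1$ $$\frac1{T^{**}_n}\bigl|\{t\in[2T^{**}_n,3T^{**}_n]:\mathcal L_0(t)\in \mathrm{RS}(\beta_0)\}\bigr|>1-\varepsilon.$$ Furthermore, for every integer $n\ge1$, define the gate size $\beta_1=\beta_1(\alpha,n)$ and the height $y_1=y_1(\alpha,n)$ by $$\beta_1=\sum_{i\ \mathrm{even}}2\eta_i-\sum_{\substack{i\ \mathrm{odd}\\ i<2n+2}}2\eta_i,\qquad y_1=1-\sum_{i\ \mathrm{even}}2\eta_i-\sum_{\substack{i\ \mathrm{odd}\\ i<2n+2}}3\eta_i-\sum_{\substack{i\ \mathrm{odd}\\ i>2n+2}}2\eta_i .$$ Then $0<\beta_1<1$, $|\beta_1-\beta_0|<\varepsilon$, and there is an $\alpha$-geodesic $\mathcal L_1$ on the 2-square-$\beta_1$ surface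 that starts from the point at height $y_1$ of the left edge of the left square and has the following two properties. (iii) There are positive real numbers $W_1,\ldots,W_n$ with $W_{i+1}>2W_i$ for $1\le i<n$, such that for every $i=1,\ldots,n$ $$\frac1{W_i}\bigl|\{t\in[0,W_i]:\mathcal L_1(t)\in \mathrm{LS}(\beta_1)\}\bigr|>1-\varepsilon \quad\text{and}\quad \frac1{W_i}\bigl|\{t\in[W_i,2W_i]:\mathcal L_1(t)\in \mathrm{RS}(\beta_1)\}\bigr|>1-\varepsilon.$$ (iv) There is a threshold $W^\star>0$ such that for every real number $W>W^\star$ $$\frac1{W}\bigl|\{t\in[0,W]:\mathcal L_1(t)\in \mathrm{LS}(\beta_1)\}\bigr|>\frac23-\varepsilon.$$ -/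

import Mathlib

/-! ## The 2-square-b surface -/

/-- The two constituent squares. -/
inductive Side where
  | left
  | right

/-- The square other than the given one. -/
def Side.other : Side → Side
  | Side.left => Side.right
  | Side.right => Side.left

/-- A point of the disjoint union of two closed unit squares, given by the square that contains it
and its coordinates in that square (measured from the lower left vertex of the square). -/
structure SquarePoint where
  side : Side
  x : ℝ
  y : ℝ
  hx : x ∈ Set.Icc (0 : ℝ) 1
  hy : y ∈ Set.Icc (0 : ℝ) 1

/-- The edge identifications of the 2-square-b surface (`0 < b < 1`). The top edge of each square is
identified with its bottom edge. The gates are the lowest parts, of length `b`, of the right edges: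
the gate of one square leads to the left edge of the other square. The rest of the right edge
is a barrier, and it is identified with the corresponding part of the left edge of the same
square. -/
inductive Glue (b : ℝ) : SquarePoint → SquarePoint → Prop
  | horizontal (σ : Side) (x : ℝ) (hx : x ∈ Set.Icc (0 : ℝ) 1) :
      Glue b ⟨σ, x, 0, hx, Set.left_mem_Icc.2 zero_le_one⟩
        ⟨σ, x, 1, hx, Set.right_mem_Icc.2 zero_le_one⟩
  | gate (σ : Side) (y : ℝ) (hy : y ∈ Set.Icc (0 : ℝ) 1) (h : y ≤ b) :
      Glue b ⟨σ, 1, y, Set.right_mem_Icc.2 zero_le_one, hy⟩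
        ⟨σ.other, 0, y, Set.left_mem_Icc.2 zero_le_one, hy⟩
  | barrier (σ : Side) (y : ℝ) (hy : y ∈ Set.Icc (0 : ℝ) 1) (h : b ≤ y) :
      Glue b ⟨σ, 1, y, Set.right_mem_Icc.2 zero_le_one, hy⟩
        ⟨σ, 0, y, Set.left_mem_Icc.2 zero_le_one, hy⟩

/-- The 2-square-b surface: two closed unit squares modulo the edge identifications. -/
def TwoSquareSurface (b : ℝ) : Type := Quot (Glue b)

/-- The point of the surface that a point of the two squares represents. -/
def TwoSquareSurface.mk (b : ℝ) (p : SquarePoint) : TwoSquareSurface b := Quot.mk (Glue b) p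

/-- The constituent square on the given side, as a closed subset of the surface. -/
def constituentSquare (b : ℝ) (σ : Side) : Set (TwoSquareSurface b) :=
  {P | ∃ p : SquarePoint, p.side = σ ∧ P = TwoSquareSurface.mk b p}

/-- A half-infinite `α`-geodesic, travelled at unit speed: if at time `t ≥ 0` the curve is at the
point represented by `p`, then it moves from `p` along the straight line of direction `(1, α)`, for
as long as this line stays in the closed square of `p`. Only the values of the curve at times
`t ≥ 0` matter, and these are determined by the starting point. All representatives `p` of the
point have to be respected, so (for `0 < b < 1`) such a curve never hits a singularity of the
surface: the vertices of the squares and the endpoints of the gates have representatives on the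
left edges of both squares, with different continuations. -/
def IsGeodesic (b α : ℝ) (L : ℝ → TwoSquareSurface b) : Prop :=
  ∀ (t s : ℝ) (p q : SquarePoint), 0 ≤ t → 0 ≤ s →
    L t = TwoSquareSurface.mk b p →
    q.side = p.side →
    q.x = p.x + s * (1 / Real.sqrt (1 + α ^ 2)) →
    q.y = p.y + s * (α / Real.sqrt (1 + α ^ 2)) →
    L (t + s) = TwoSquareSurface.mk b q

/-- The curve starts from the point at height `y` on the left edge of the left square. -/
def StartsAtHeight (b : ℝ) (L : ℝ → TwoSquareSurface b) (y : ℝ) : Prop :=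
  ∃ p : SquarePoint, p.side = Side.left ∧ p.x = 0 ∧ p.y = y ∧ L 0 = TwoSquareSurface.mk b p

/-- The total time that the curve spends in the square on side `σ` during the interval `[u, v]`. -/
noncomputable def visitTime {b : ℝ} (L : ℝ → TwoSquareSurface b) (σ : Side) (u v : ℝ) : ℝ :=
  (MeasureTheory.volume {t : ℝ | t ∈ Set.Icc u v ∧ L t ∈ constituentSquare b σ}).toReal

/-! ## The gates and the starting points -/

/-- `η_i = q_i α - p_i`, where `p_i / q_i` is the `i`-th convergent of the continued fraction
of `α`; for `0 < α < 1`, `p_0 / q_0 = 0 / 1` and `p_1 / q_1 = 1 / a_1`. -/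
noncomputable def eta (α : ℝ) (i : ℕ) : ℝ :=
  (GenContFract.of α).dens i * α - (GenContFract.of α).nums i

/-- The sum `c_0 η_0 + c_1 η_1 + c_2 η_2 + ⋯`. -/
noncomputable def etaSum (α : ℝ) (c : ℕ → ℤ) : ℝ := ∑' i : ℕ, (c i : ℝ) * eta α i

/-- The gate size `β_0(α)`. Its coefficients `2, -2, 2, -2, …` are the differences of the digits
`4, 0, 4, 0, …` and `2, 2, 2, 2, …`. -/
noncomputable def gateZero (α : ℝ) : ℝ :=
  etaSum α (fun i => if Even i then 2 else -2)

/-- The height of the starting point that belongs to `β_0(α)`. -/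
noncomputable def startZero (α : ℝ) : ℝ :=
  1 - etaSum α (fun i => if Even i then 2 else 3)

/-- The gate size `β_1(α, n)`. Its coefficients are those of `β_0(α)`, except that the ones with
odd index `i > 2n + 2` are replaced by `0`. -/
noncomputable def gateOne (α : ℝ) (n : ℕ) : ℝ :=
  etaSum α (fun i => if Even i then 2 else if i < 2 * n + 2 then -2 else 0)

/-- The height of the starting point that belongs to `β_1(α, n)`. -/
noncomputable def startOne (α : ℝ) (n : ℕ) : ℝ :=
  1 - etaSum α (fun i => if Even i then 2 else if i < 2 * n + 2 then 3 else 2)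

/-!
The geodesic crosses right edges at the heights `y₀ + k α` modulo `1`, and it changes the square
exactly at the crossings with `k α ∈ [A, B]` modulo `1`, where `A = ∑ c_i η_i` and
`B = ∑ c'_i η_i` have the digits `2, 3, 2, 3, …` and `4, 1, 4, 1, …` (for the second gate, the late
odd digits are `2` in both). So its position after `K` crossings is the parity of the number of
`k ≤ K` that hit the gate, that is, of `∑_{k ≤ K} (⌊k α - A⌋ - ⌊k α - B⌋)`.

*Reduction to finitely many digits.* The partial sums of the two series are, modulo `1`, the orbit
points `u α` and `u' α`, where `u = ∑_{i < n} c_i q_i` and `u' = ∑_{i < n} c'_i q_i`. For odd `n` and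
`k < q_n`, best approximation shows that no orbit point separates the partial sums from the full
sums, and `⌊k α - A⌋ = ⌊(k - u) α⌋ + const` (`LargeDigits.floor_sub_digitPoint`). It also shows that
no singularity is hit.

*Parity.* Let `G` be a primitive of `⌊k α⌋`. The digits of `u' - u` are even, so
modulo `2` the count above is the increment of `G (K - u) - G (K - u')` between `0` and `K`. This
splits into second differences of `G` with one of the steps equal to `q_i`. Such a second
difference counts the returns of level `i`, the times `j` with `j α` modulo `1` between `0` and
`η_i`, in a short window (`LargeDigits.floorSum_second_difference`). This expresses the parity as a
sum of contributions of the single levels (`LargeDigits.gateCount_cast_eq`).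

*Counting.* Returns of level `i` are at least `q_{i+1}` apart, and the windows have length about
`q_i`, so on long blocks level `i` contributes only in a proportion of order `1 / a_i` of the time
(`LargeDigits.sum_levelCount_le`; here `a_i` is the digit with `q_{i+1} ≈ a_i q_i`). The sum of these
proportions is small. On the scale of `q_m`, `K < q_{m+1}`, only the return of level `m` closest to
`0` remains. For even `m` it flips the square for `2 q_m ≤ K < 3 q_m`, and for odd `m` with the digits
`3` and `1` for `q_m ≤ K < 2 q_m` (`LargeDigits.resonant_of_even`, `LargeDigits.resonant_of_odd`).
When the late odd levels are switched off, only the intervals `[2 q_m, 3 q_m)` with even `m` are left,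
and these take up at most about one third of every long initial segment
(`LargeDigits.card_right_le`).
-/

/-! ### Straight trajectories on the surface -/

theorem Side.other_ne (σ : Side) : σ.other ≠ σ := by cases σ <;> simp [Side.other]

/-- `p` is one of the points of the two squares that represent the trajectory at the moment when
its horizontal displacement is `s`: after `K` crossings of right edges it is in the square `σ K`,
and it has crossed `j` horizontal edges. On an edge several pairs `(K, j)` qualify. -/
def Represents (α y₀ : ℝ) (σ : ℤ → Side) (s : ℝ) (p : SquarePoint) : Prop :=
  ∃ K j : ℤ, p.side = σ K ∧ p.x = s - K ∧ p.y = y₀ + s * α - j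

/-- The sequence of squares `σ` obeys the gates: at the `k`-th crossing, `k ≥ 0`, it changes the
square at a gate point and keeps it at a barrier point. No singularity can be hit then, as such a
point is both a gate point and a barrier point. -/
structure ObeysGates (b α y₀ : ℝ) (σ : ℤ → Side) : Prop where
  gate : ∀ k j : ℤ, 0 ≤ k → 0 ≤ y₀ + k * α - j → y₀ + k * α - j ≤ b → σ k = (σ (k - 1)).other
  barrier : ∀ k j : ℤ, 0 ≤ k → b ≤ y₀ + k * α - j → y₀ + k * α - j ≤ 1 → σ k = σ (k - 1)

section Trajectory

variable {b α y₀ : ℝ} {σ : ℤ → Side}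

theorem ObeysGates.represents_iff (h : ObeysGates b α y₀ σ) {s : ℝ} (hs : 0 ≤ s)
    {p q : SquarePoint} (hpq : Glue b p q) :
    Represents α y₀ σ s p ↔ Represents α y₀ σ s q := by
  cases hpq with
  | horizontal τ x hx =>
    constructor
    · rintro ⟨K, j, h1, h2, h3⟩
      refine ⟨K, j - 1, h1, h2, ?_⟩
      push_cast; simp only at h3 ⊢; linarith
    · rintro ⟨K, j, h1, h2, h3⟩
      refine ⟨K, j + 1, h1, h2, ?_⟩
      push_cast; simp only at h3 ⊢; linarith
  | gate τ y hy hb =>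
    constructor
    · rintro ⟨K, j, h1, h2, h3⟩
      simp only at h1 h2 h3
      have hsK : s = ((K + 1 : ℤ) : ℝ) := by push_cast; linarith
      refine ⟨K + 1, j, ?_, by simp only; linarith, h3⟩
      have hK : 0 ≤ K + 1 := by rw [hsK] at hs; exact_mod_cast hs
      have := h.gate (K + 1) j hK (by rw [← hsK, ← h3]; exact hy.1) (by rw [← hsK, ← h3]; exact hb)
      simp only [this, add_sub_cancel_right, h1]
    · rintro ⟨K, j, h1, h2, h3⟩
      simp only at h1 h2 h3
      have hsK : s = K := by linarith
      refine ⟨K - 1, j, ?_, by push_cast; linarith, h3⟩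
      have hK : 0 ≤ K := by rw [hsK] at hs; exact_mod_cast hs
      have := h.gate K j hK (by rw [← hsK, ← h3]; exact hy.1) (by rw [← hsK, ← h3]; exact hb)
      rw [← h1] at this
      simp only
      revert this
      generalize σ (K - 1) = ρ
      cases τ <;> cases ρ <;> simp [Side.other]
  | barrier τ y hy hb =>
    constructor
    · rintro ⟨K, j, h1, h2, h3⟩
      simp only at h1 h2 h3
      have hsK : s = ((K + 1 : ℤ) : ℝ) := by push_cast; linarith
      refine ⟨K + 1, j, ?_, by simp only; linarith, h3⟩
      have hK : 0 ≤ K + 1 := by rw [hsK] at hs; exact_mod_cast hs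
      have := h.barrier (K + 1) j hK (by rw [← hsK, ← h3]; exact hb)
        (by rw [← hsK, ← h3]; exact hy.2)
      simp only [this, add_sub_cancel_right, h1]
    · rintro ⟨K, j, h1, h2, h3⟩
      simp only at h1 h2 h3
      have hsK : s = K := by linarith
      refine ⟨K - 1, j, ?_, by push_cast; linarith, h3⟩
      have hK : 0 ≤ K := by rw [hsK] at hs; exact_mod_cast hs
      have := h.barrier K j hK (by rw [← hsK, ← h3]; exact hb) (by rw [← hsK, ← h3]; exact hy.2)
      simp only [← this, h1]

theorem ObeysGates.represents_of_mk_eq (h : ObeysGates b α y₀ σ) {s : ℝ} (hs : 0 ≤ s)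
    {p q : SquarePoint} (hpq : TwoSquareSurface.mk b p = TwoSquareSurface.mk b q)
    (hp : Represents α y₀ σ s p) : Represents α y₀ σ s q := by
  let f : TwoSquareSurface b → Prop :=
    Quot.lift (Represents α y₀ σ s) fun _ _ hab => propext (h.represents_iff hs hab)
  have : f (TwoSquareSurface.mk b p) = f (TwoSquareSurface.mk b q) := by rw [hpq]
  exact this.mp hp

theorem mk_eq_of_same_side {K j j' : ℤ} {s : ℝ} {p q : SquarePoint}
    (hp1 : p.side = σ K) (hp2 : p.x = s - K) (hp3 : p.y = y₀ + s * α - j)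
    (hq1 : q.side = σ K) (hq2 : q.x = s - K) (hq3 : q.y = y₀ + s * α - j') :
    TwoSquareSurface.mk b p = TwoSquareSurface.mk b q := by
  obtain ⟨σp, xp, yp, hxp, hyp⟩ := p
  obtain ⟨σq, xq, yq, hxq, hyq⟩ := q
  simp only at hp1 hp2 hp3 hq1 hq2 hq3
  obtain rfl : σp = σq := by rw [hp1, hq1]
  obtain rfl : xp = xq := by rw [hp2, hq2]
  have hd : yp - yq = ((j' - j : ℤ) : ℝ) := by push_cast; linarith
  have h1 : (-1 : ℤ) ≤ j' - j := by
    have : ((-1 : ℤ) : ℝ) ≤ ((j' - j : ℤ) : ℝ) := by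
      rw [← hd]; push_cast; linarith [hyp.1, hyq.2]
    exact_mod_cast this
  have h2 : j' - j ≤ (1 : ℤ) := by
    have : ((j' - j : ℤ) : ℝ) ≤ ((1 : ℤ) : ℝ) := by
      rw [← hd]; push_cast; linarith [hyp.2, hyq.1]
    exact_mod_cast this
  obtain h3 | h3 | h3 : j' - j = -1 ∨ j' - j = 0 ∨ j' - j = 1 := by omega
  · rw [h3] at hd; push_cast at hd
    obtain rfl : yp = 0 := by linarith [hyp.1, hyq.2]
    obtain rfl : yq = 1 := by linarith
    exact Quot.sound (Glue.horizontal _ _ hxp)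
  · rw [h3] at hd; push_cast at hd
    obtain rfl : yp = yq := by linarith
    rfl
  · rw [h3] at hd; push_cast at hd
    obtain rfl : yq = 0 := by linarith [hyp.2, hyq.1]
    obtain rfl : yp = 1 := by linarith
    exact (Quot.sound (Glue.horizontal _ _ hxp)).symm

theorem ObeysGates.height_ne_int (h : ObeysGates b α y₀ σ) (hb0 : 0 < b) (hb1 : b < 1) {k : ℤ}
    (hk : 0 ≤ k) (j : ℤ) : y₀ + k * α ≠ j := by
  intro he
  have h1 := h.gate k j hk (by linarith) (by linarith)
  have h2 := h.barrier k (j - 1) hk (by push_cast; linarith) (by push_cast; linarith)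
  exact Side.other_ne _ (h1.symm.trans h2)

theorem ObeysGates.mk_eq_of_succ (h : ObeysGates b α y₀ σ) (hb0 : 0 < b) (hb1 : b < 1)
    {K j j' : ℤ} {s : ℝ} (hs : 0 ≤ s) {p q : SquarePoint}
    (hp1 : p.side = σ K) (hp2 : p.x = s - K) (hp3 : p.y = y₀ + s * α - j)
    (hq1 : q.side = σ (K + 1)) (hq2 : q.x = s - (K + 1)) (hq3 : q.y = y₀ + s * α - j') :
    TwoSquareSurface.mk b p = TwoSquareSurface.mk b q := by
  obtain ⟨σp, xp, yp, hxp, hyp⟩ := p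
  obtain ⟨σq, xq, yq, hxq, hyq⟩ := q
  simp only at hp1 hp2 hp3 hq1 hq2 hq3
  obtain rfl : xp = 1 := by linarith [hxp.2, hxq.1]
  obtain rfl : xq = 0 := by linarith
  have hsK : s = ((K + 1 : ℤ) : ℝ) := by push_cast; linarith
  have hK : 0 ≤ K + 1 := by rw [hsK] at hs; exact_mod_cast hs
  have hne := h.height_ne_int hb0 hb1 hK
  rw [← hsK] at hne
  have h0 : 0 < yp := lt_of_le_of_ne hyp.1 fun e => hne j (by linarith)
  have h0' : 0 < yq := lt_of_le_of_ne hyq.1 fun e => hne j' (by linarith)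
  have h1 : yp < 1 := lt_of_le_of_ne hyp.2 fun e => hne (j + 1) (by push_cast; linarith)
  have h1' : yq < 1 := lt_of_le_of_ne hyq.2 fun e => hne (j' + 1) (by push_cast; linarith)
  obtain rfl : j = j' := by
    have e1 : (j : ℝ) < ((j' + 1 : ℤ) : ℝ) := by push_cast; linarith
    have e2 : (j' : ℝ) < ((j + 1 : ℤ) : ℝ) := by push_cast; linarith
    have e1 : j < j' + 1 := by exact_mod_cast e1
    have e2 : j' < j + 1 := by exact_mod_cast e2
    omega
  obtain rfl : yp = yq := by linarith
  rw [hsK] at hp3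
  rcases le_total yp b with hb | hb
  · have := h.gate (K + 1) j hK (by linarith) (by linarith)
    rw [add_sub_cancel_right, ← hq1, ← hp1] at this
    subst this
    exact Quot.sound (Glue.gate _ _ hyp hb)
  · have := h.barrier (K + 1) j hK (by linarith) (by linarith)
    rw [add_sub_cancel_right, ← hq1, ← hp1] at this
    subst this
    exact Quot.sound (Glue.barrier _ _ hyp hb)

theorem ObeysGates.mk_eq_of_represents (h : ObeysGates b α y₀ σ) (hb0 : 0 < b) (hb1 : b < 1)
    {s : ℝ} (hs : 0 ≤ s) {p q : SquarePoint} (hp : Represents α y₀ σ s p)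
    (hq : Represents α y₀ σ s q) : TwoSquareSurface.mk b p = TwoSquareSurface.mk b q := by
  obtain ⟨K, j, hp1, hp2, hp3⟩ := hp
  obtain ⟨K', j', hq1, hq2, hq3⟩ := hq
  have e1 : (K : ℝ) ≤ ((K' + 1 : ℤ) : ℝ) := by push_cast; linarith [p.hx.1, q.hx.2]
  have e2 : (K' : ℝ) ≤ ((K + 1 : ℤ) : ℝ) := by push_cast; linarith [p.hx.2, q.hx.1]
  have e1 : K ≤ K' + 1 := by exact_mod_cast e1
  have e2 : K' ≤ K + 1 := by exact_mod_cast e2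
  obtain rfl | rfl | rfl : K' = K ∨ K' = K + 1 ∨ K = K' + 1 := by omega
  · exact mk_eq_of_same_side hp1 hp2 hp3 hq1 hq2 hq3
  · exact h.mk_eq_of_succ hb0 hb1 hs hp1 hp2 hp3 hq1 (by rw [hq2]; push_cast; ring) hq3
  · exact (h.mk_eq_of_succ hb0 hb1 hs hq1 hq2 hq3 hp1 (by rw [hp2]; push_cast; ring) hp3).symm

/-- The representative of the trajectory at horizontal displacement `s` that lies on the left edge
rather than the right edge, and on the bottom edge rather than the top edge. -/
noncomputable def trajectoryPoint (α y₀ : ℝ) (σ : ℤ → Side) (s : ℝ) : SquarePoint where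
  side := σ ⌊s⌋
  x := Int.fract s
  y := Int.fract (y₀ + s * α)
  hx := ⟨Int.fract_nonneg _, (Int.fract_lt_one _).le⟩
  hy := ⟨Int.fract_nonneg _, (Int.fract_lt_one _).le⟩

theorem represents_trajectoryPoint (α y₀ : ℝ) (σ : ℤ → Side) (s : ℝ) :
    Represents α y₀ σ s (trajectoryPoint α y₀ σ s) :=
  ⟨⌊s⌋, ⌊y₀ + s * α⌋, rfl, rfl, rfl⟩

/-- A sequence of squares that obeys the gates is the itinerary of a geodesic. -/
theorem ObeysGates.exists_geodesic (h : ObeysGates b α y₀ σ) (hb0 : 0 < b) (hb1 : b < 1)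
    (hy : y₀ ∈ Set.Ico (0 : ℝ) 1) (h0 : σ 0 = Side.left) :
    ∃ L : ℝ → TwoSquareSurface b, IsGeodesic b α L ∧ StartsAtHeight b L y₀ ∧
      ∀ t, L t ∈ constituentSquare b (σ ⌊t / Real.sqrt (1 + α ^ 2)⌋) := by
  have hc : 0 < Real.sqrt (1 + α ^ 2) := Real.sqrt_pos.2 (by positivity)
  refine ⟨fun t => TwoSquareSurface.mk b (trajectoryPoint α y₀ σ (t / Real.sqrt (1 + α ^ 2))),
    ?_, ?_, ?_⟩
  · intro t s p q ht hs hL hside hx hy'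
    have ht' : 0 ≤ t / Real.sqrt (1 + α ^ 2) := by positivity
    have hs' : 0 ≤ (t + s) / Real.sqrt (1 + α ^ 2) := by positivity
    obtain ⟨K, j, h1, h2, h3⟩ := h.represents_of_mk_eq ht' hL (represents_trajectoryPoint _ _ _ _)
    refine h.mk_eq_of_represents hb0 hb1 hs' (represents_trajectoryPoint _ _ _ _)
      ⟨K, j, hside.trans h1, ?_, ?_⟩
    · rw [hx, h2]; ring
    · rw [hy', h3]; ring
  · refine ⟨trajectoryPoint α y₀ σ 0, by simp [trajectoryPoint, h0], by simp [trajectoryPoint],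
      ?_, by simp⟩
    simp only [trajectoryPoint, zero_mul, add_zero]
    exact Int.fract_eq_self.2 hy
  · exact fun t => ⟨_, rfl, rfl⟩

/-- The time spent in a square is at least the time between consecutive crossings, multiplied by
the number of crossings after which the itinerary is in this square. -/
theorem card_mul_le_visitTime {c : ℝ} (hc : 0 < c) {L : ℝ → TwoSquareSurface b}
    (hL : ∀ t, L t ∈ constituentSquare b (σ ⌊t / c⌋)) (τ : Side) {u v : ℝ} {S : Finset ℤ}
    (hS : ∀ K ∈ S, σ K = τ ∧ u ≤ c * K ∧ c * (K + 1) ≤ v) :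
    c * S.card ≤ visitTime L τ u v := by
  classical
  have hmeas : MeasureTheory.volume (⋃ K ∈ S, Set.Ico (c * (K : ℝ)) (c * (K + 1)))
      = ENNReal.ofReal (c * S.card) := by
    rw [MeasureTheory.measure_biUnion_finset]
    · have : ∀ K : ℤ, MeasureTheory.volume (Set.Ico (c * (K : ℝ)) (c * (K + 1)))
          = ENNReal.ofReal c := by
        intro K; rw [Real.volume_Ico]; congr 1; ring
      simp only [this, Finset.sum_const, nsmul_eq_mul]
      rw [mul_comm c, ENNReal.ofReal_mul (by positivity), ENNReal.ofReal_natCast]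
    · intro K _ K' _ hne
      rw [Function.onFun, Set.disjoint_left]
      rintro t ⟨h1, h2⟩ ⟨h3, h4⟩
      apply hne
      have e1 : (K : ℝ) < ((K' + 1 : ℤ) : ℝ) := by
        push_cast; exact lt_of_mul_lt_mul_left (h1.trans_lt h4) hc.le
      have e2 : (K' : ℝ) < ((K + 1 : ℤ) : ℝ) := by
        push_cast; exact lt_of_mul_lt_mul_left (h3.trans_lt h2) hc.le
      have e1 : K < K' + 1 := by exact_mod_cast e1
      have e2 : K' < K + 1 := by exact_mod_cast e2
      omega
    · exact fun _ _ => measurableSet_Ico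
  have hsub : (⋃ K ∈ S, Set.Ico (c * (K : ℝ)) (c * (K + 1)))
      ⊆ {t : ℝ | t ∈ Set.Icc u v ∧ L t ∈ constituentSquare b τ} := by
    intro t ht
    simp only [Set.mem_iUnion] at ht
    obtain ⟨K, hK, h1, h2⟩ := ht
    obtain ⟨e1, e2, e3⟩ := hS K hK
    refine ⟨⟨by linarith, by linarith⟩, ?_⟩
    have hfl : ⌊t / c⌋ = K := by
      rw [Int.floor_eq_iff]
      constructor
      · rw [le_div_iff₀ hc]; linarith
      · rw [div_lt_iff₀ hc]; linarith
    have := hL t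
    rwa [hfl, e1] at this
  have hfin : MeasureTheory.volume {t : ℝ | t ∈ Set.Icc u v ∧ L t ∈ constituentSquare b τ} ≠ ⊤ :=
    ((MeasureTheory.measure_mono (fun t ht => ht.1)).trans_lt
      (by rw [Real.volume_Icc]; exact ENNReal.ofReal_lt_top)).ne
  have := ENNReal.toReal_mono hfin (MeasureTheory.measure_mono hsub)
  rwa [hmeas, ENNReal.toReal_ofReal (by positivity)] at this

end Trajectory

/-! ### Continued fractions with large digits -/

/-- The denominators of the convergents of `[a 0, a 1, a 2, …]`, as integers. -/
def cfDen (a : ℕ → ℕ) : ℕ → ℤ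
  | 0 => 1
  | 1 => a 0
  | n + 2 => a (n + 1) * cfDen a (n + 1) + cfDen a n

/-- The numerators of the convergents of `[a 0, a 1, a 2, …]`, as integers. -/
def cfNum (a : ℕ → ℕ) : ℕ → ℤ
  | 0 => 0
  | 1 => 1
  | n + 2 => a (n + 1) * cfNum a (n + 1) + cfNum a n

/-- The signed error `q_i α - p_i` of the `i`-th convergent of `[a 0, a 1, a 2, …]`. -/
noncomputable def cfEta (α : ℝ) (a : ℕ → ℕ) (i : ℕ) : ℝ := cfDen a i * α - cfNum a i

theorem cfEta_zero (α : ℝ) (a : ℕ → ℕ) : cfEta α a 0 = α := by simp [cfEta, cfDen, cfNum]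

theorem cfEta_add_two (α : ℝ) (a : ℕ → ℕ) (i : ℕ) :
    cfEta α a (i + 2) = a (i + 1) * cfEta α a (i + 1) + cfEta α a i := by
  simp only [cfEta, cfDen, cfNum]; push_cast; ring

theorem cfDen_mul_cfNum_sub (a : ℕ → ℕ) (n : ℕ) :
    cfDen a n * cfNum a (n + 1) - cfDen a (n + 1) * cfNum a n = (-1) ^ n := by
  induction n with
  | zero => simp [cfDen, cfNum]
  | succ n ih => rw [pow_succ, ← ih]; simp only [cfDen, cfNum]; ring

/-- The number `α` has the continued fraction digits `a`, and they are all greater than `300`. The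
relation between `α` and `a` enters only through the alternating signs of the errors of the
convergents. -/
structure LargeDigits (α : ℝ) (a : ℕ → ℕ) : Prop where
  large : ∀ i, 300 < a i
  sign : ∀ i, 0 < (-1) ^ i * cfEta α a i

section Translation

variable {α : ℝ} {a : ℕ → ℕ}

theorem of_s_get?_of_partDens {i : ℕ} {d : ℝ}
    (h : (GenContFract.of α).partDens.get? i = some d) :
    (GenContFract.of α).s.get? i = some ⟨1, d⟩ := by
  obtain ⟨gp, h1, h2⟩ := GenContFract.exists_s_b_of_partDen h
  rw [h1]
  have := GenContFract.of_partNum_eq_one (GenContFract.partNum_eq_s_a h1)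
  obtain ⟨x, y⟩ := gp
  simp only at this h2
  rw [this, h2]

theorem dens_nums_eq_cf (hα0 : 0 < α) (hα1 : α < 1)
    (ha : ∀ i, (GenContFract.of α).partDens.get? i = some (a i : ℝ)) (i : ℕ) :
    (GenContFract.of α).dens i = cfDen a i ∧ (GenContFract.of α).nums i = cfNum a i := by
  have hh : (GenContFract.of α).h = 0 := by
    rw [GenContFract.of_h_eq_floor, Int.floor_eq_zero_iff.2 ⟨hα0.le, hα1⟩]; simp
  induction i using Nat.twoStepInduction with
  | zero =>
    rw [GenContFract.zeroth_den_eq_one, GenContFract.zeroth_num_eq_h, hh]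
    simp [cfDen, cfNum]
  | one =>
    have := of_s_get?_of_partDens (ha 0)
    rw [GenContFract.first_den_eq this, GenContFract.first_num_eq this, hh]
    simp [cfDen, cfNum]
  | more i h1 h2 =>
    have := of_s_get?_of_partDens (ha (i + 1))
    rw [GenContFract.dens_recurrence this h1.1 h2.1, GenContFract.nums_recurrence this h1.2 h2.2]
    constructor <;> simp [cfDen, cfNum]

theorem eta_eq_cfEta (hα0 : 0 < α) (hα1 : α < 1)
    (ha : ∀ i, (GenContFract.of α).partDens.get? i = some (a i : ℝ)) (i : ℕ) :
    eta α i = cfEta α a i := by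
  rw [eta, cfEta, (dens_nums_eq_cf hα0 hα1 ha i).1, (dens_nums_eq_cf hα0 hα1 ha i).2]

theorem one_le_of_partDens (ha : ∀ i, (GenContFract.of α).partDens.get? i = some (a i : ℝ))
    (i : ℕ) : 1 ≤ a i := by
  exact_mod_cast GenContFract.of_one_le_get?_partDen (ha i)

theorem cfDen_pos (ha : ∀ i, 1 ≤ a i) (i : ℕ) : 0 < cfDen a i := by
  induction i using Nat.twoStepInduction with
  | zero => simp [cfDen]
  | one => have := ha 0; simp only [cfDen]; positivity
  | more i h1 h2 => simp only [cfDen]; positivity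

theorem cfEta_sign (hα0 : 0 < α) (hα1 : α < 1)
    (ha : ∀ i, (GenContFract.of α).partDens.get? i = some (a i : ℝ)) (i : ℕ) :
    0 < (-1) ^ i * cfEta α a i := by
  obtain ⟨ifp', h1, -⟩ := GenContFract.IntFractPair.exists_succ_get?_stream_of_gcf_of_get?_eq_some
    (of_s_get?_of_partDens (ha i))
  obtain ⟨ifp, h2, h3, -⟩ := GenContFract.IntFractPair.succ_nth_stream_eq_some_iff.1 h1
  have h4 := GenContFract.sub_convs_eq h2
  simp only [if_neg h3] at h4
  have hfr : 0 < ifp.fr :=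
    lt_of_le_of_ne (GenContFract.IntFractPair.nth_stream_fr_nonneg h2) (Ne.symm h3)
  have hB : ((GenContFract.of α).contsAux (i + 1)).b = cfDen a i :=
    (dens_nums_eq_cf hα0 hα1 ha i).1
  have hpB : 0 ≤ ((GenContFract.of α).contsAux i).b := GenContFract.zero_le_of_contsAux_b
  have hq : (0 : ℝ) < cfDen a i := by exact_mod_cast cfDen_pos (one_le_of_partDens ha) i
  rw [hB, GenContFract.conv_eq_num_div_den, (dens_nums_eq_cf hα0 hα1 ha i).1,
    (dens_nums_eq_cf hα0 hα1 ha i).2] at h4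
  have hD : 0 < (ifp.fr)⁻¹ * (cfDen a i : ℝ) + ((GenContFract.of α).contsAux i).b := by positivity
  have h5 : cfEta α a i =
      (-1) ^ i / ((ifp.fr)⁻¹ * (cfDen a i : ℝ) + ((GenContFract.of α).contsAux i).b) := by
    have : cfEta α a i = cfDen a i * (α - cfNum a i / cfDen a i) := by
      rw [cfEta]; field_simp
    rw [this, h4]; field_simp
  rw [h5, mul_div_assoc', ← mul_pow]
  simp only [mul_neg, mul_one, neg_neg, one_pow]
  positivity

end Translation

namespace LargeDigits

variable {α : ℝ} {a : ℕ → ℕ}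

theorem den_pos (h : LargeDigits α a) (i : ℕ) : 0 < cfDen a i :=
  cfDen_pos (fun i => by have := h.large i; omega) i

theorem digit_mul_den_le (h : LargeDigits α a) (i : ℕ) : a i * cfDen a i ≤ cfDen a (i + 1) := by
  cases i with
  | zero => simp [cfDen]
  | succ i => simp only [cfDen]; have := h.den_pos i; linarith

theorem mul_den_le (h : LargeDigits α a) (i : ℕ) : 300 * cfDen a i ≤ cfDen a (i + 1) := by
  refine le_trans ?_ (h.digit_mul_den_le i)
  have : (300 : ℤ) ≤ a i := by exact_mod_cast (h.large i).le
  exact mul_le_mul_of_nonneg_right this (h.den_pos i).le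

theorem den_mono (h : LargeDigits α a) {i j : ℕ} (hij : i ≤ j) : cfDen a i ≤ cfDen a j := by
  induction j, hij using Nat.le_induction with
  | base => exact le_rfl
  | succ j _ ih => have := h.mul_den_le j; have := h.den_pos j; omega

theorem abs_eta (h : LargeDigits α a) (i : ℕ) : |cfEta α a i| = (-1) ^ i * cfEta α a i := by
  rw [← abs_of_pos (h.sign i), abs_mul, abs_pow, abs_neg, abs_one, one_pow, one_mul]

theorem abs_eta_pos (h : LargeDigits α a) (i : ℕ) : 0 < |cfEta α a i| := by
  rw [h.abs_eta]; exact h.sign i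

theorem eta_of_even (h : LargeDigits α a) {i : ℕ} (hi : Even i) :
    cfEta α a i = |cfEta α a i| := by
  rw [h.abs_eta, hi.neg_one_pow, one_mul]

theorem eta_of_odd (h : LargeDigits α a) {i : ℕ} (hi : Odd i) :
    cfEta α a i = -|cfEta α a i| := by
  rw [h.abs_eta, hi.neg_one_pow]; ring

theorem mul_abs_eta_le (h : LargeDigits α a) (i : ℕ) :
    300 * |cfEta α a (i + 1)| ≤ |cfEta α a i| := by
  have h1 := h.sign i
  have h2 := h.sign (i + 1)
  have h3 := h.sign (i + 2)
  rw [h.abs_eta, h.abs_eta]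
  rw [cfEta_add_two] at h3
  have h4 : (-1 : ℝ) ^ (i + 2) = (-1) ^ i := by rw [pow_add]; norm_num
  have h5 : (-1 : ℝ) ^ (i + 1) = -(-1) ^ i := by rw [pow_succ]; ring
  rw [h4] at h3
  rw [h5] at h2 ⊢
  have h6 : (300 : ℝ) ≤ a (i + 1) := by exact_mod_cast (h.large (i + 1)).le
  nlinarith

theorem alpha_pos (h : LargeDigits α a) : 0 < α := by
  have := h.sign 0
  rw [cfEta_zero] at this; simpa using this

theorem digit_mul_alpha_lt (h : LargeDigits α a) : a 0 * α < 1 := by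
  have := h.sign 1
  simp [cfEta, cfDen, cfNum] at this
  linarith

theorem alpha_lt (h : LargeDigits α a) : 300 * α < 1 := by
  have h1 := h.digit_mul_alpha_lt
  have h2 : (300 : ℝ) < a 0 := by exact_mod_cast h.large 0
  nlinarith [h.alpha_pos]

theorem abs_eta_le (h : LargeDigits α a) (i : ℕ) : |cfEta α a i| ≤ α := by
  induction i with
  | zero => rw [cfEta_zero, abs_of_pos h.alpha_pos]
  | succ i ih => linarith [h.mul_abs_eta_le i, abs_nonneg (cfEta α a (i + 1))]

theorem abs_eta_add_le (h : LargeDigits α a) (n j : ℕ) :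
    |cfEta α a (j + n)| ≤ |cfEta α a n| * (1 / 2) ^ j := by
  induction j with
  | zero => simp
  | succ j ih =>
    have := h.mul_abs_eta_le (j + n)
    rw [show j + 1 + n = j + n + 1 by ring, pow_succ]
    linarith [abs_nonneg (cfEta α a (j + n + 1))]

/-- The convergents are best approximations. -/
theorem abs_eta_le_abs_sub (h : LargeDigits α a) (n : ℕ) {k r : ℤ} (hk : |k| < cfDen a (n + 1))
    (hkr : k ≠ 0 ∨ r ≠ 0) : |cfEta α a n| ≤ |k * α - r| := by
  set q := cfDen a n with hq
  set p := cfNum a n with hp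
  set q' := cfDen a (n + 1) with hq'
  set p' := cfNum a (n + 1) with hp'
  have hdet : q * p' - q' * p = (-1) ^ n := cfDen_mul_cfNum_sub a n
  have hsq : ((-1 : ℤ) ^ n) * (-1) ^ n = 1 := by rw [← mul_pow]; norm_num
  have hqpos : 0 < q := h.den_pos n
  have hqpos' : 0 < q' := h.den_pos (n + 1)
  -- the coordinates of `(k, r)` in the unimodular basis given by two consecutive convergents
  obtain ⟨x, y, hkx, hrx⟩ : ∃ x y : ℤ, k = x * q + y * q' ∧ r = x * p + y * p' := by
    refine ⟨(-1) ^ n * (k * p' - r * q'), (-1) ^ n * (r * q - k * p), ?_, ?_⟩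
    · linear_combination (-(-1) ^ n * k) * hdet - k * hsq
    · linear_combination (-(-1) ^ n * r) * hdet - r * hsq
  have hval : k * α - r = x * cfEta α a n + y * cfEta α a (n + 1) := by
    rw [hkx, hrx]; simp only [cfEta]; push_cast; ring
  have h1 := h.sign n
  have h2 := h.sign (n + 1)
  have h3 : (-1 : ℝ) ^ (n + 1) = -(-1) ^ n := by rw [pow_succ]; ring
  rw [h3] at h2
  have habs : |k * α - r|
      = |x * ((-1) ^ n * cfEta α a n) - y * (-(-1) ^ n * cfEta α a (n + 1))| := by
    have h4 : |(-1 : ℝ) ^ n| = 1 := by simp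
    calc |k * α - r| = |(-1 : ℝ) ^ n| * |k * α - r| := by rw [h4, one_mul]
      _ = _ := by rw [← abs_mul, hval]; congr 1; ring
  rw [habs, h.abs_eta]
  rw [abs_lt] at hk
  have hx : x ≠ 0 := by
    rintro rfl
    have : y = 0 := by
      by_contra hy
      rcases lt_or_gt_of_ne hy with hy | hy <;> nlinarith
    subst this
    simp_all
  rcases lt_or_gt_of_ne hx with hx | hx
  · have hy : 0 ≤ y := by
      by_contra hy
      push Not at hy
      nlinarith
    have hx' : (x : ℝ) ≤ -1 := by exact_mod_cast (by omega : x ≤ -1)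
    have hy' : (0 : ℝ) ≤ y := by exact_mod_cast hy
    rw [abs_of_nonpos (by nlinarith)]
    nlinarith
  · have hy : y ≤ 0 := by
      by_contra hy
      push Not at hy
      nlinarith
    have hx' : (1 : ℝ) ≤ x := by exact_mod_cast (by omega : 1 ≤ x)
    have hy' : (y : ℝ) ≤ 0 := by exact_mod_cast hy
    rw [abs_of_nonneg (by nlinarith)]
    nlinarith

theorem abs_term_le (h : LargeDigits α a) {c : ℕ → ℤ} (hc : ∀ i, |c i| ≤ 4) (n j : ℕ) :
    ‖(c (j + n) : ℝ) * cfEta α a (j + n)‖ ≤ 4 * |cfEta α a n| * (1 / 2) ^ j := by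
  rw [Real.norm_eq_abs, abs_mul, mul_assoc]
  have : |(c (j + n) : ℝ)| ≤ 4 := by exact_mod_cast hc (j + n)
  exact mul_le_mul this (h.abs_eta_add_le n j) (abs_nonneg _) (by norm_num)

theorem summable_mul_eta (h : LargeDigits α a) {c : ℕ → ℤ} (hc : ∀ i, |c i| ≤ 4) :
    Summable fun i => (c i : ℝ) * cfEta α a i :=
  Summable.of_norm_bounded
    ((summable_geometric_of_lt_one (by norm_num) (by norm_num : (1 / 2 : ℝ) < 1)).mul_left _)
    (h.abs_term_le hc 0)

theorem abs_tsum_sub_sum_le (h : LargeDigits α a) {c : ℕ → ℤ} (hc : ∀ i, |c i| ≤ 4) (n : ℕ) :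
    |(∑' i, (c i : ℝ) * cfEta α a i) - ∑ i ∈ Finset.range n, (c i : ℝ) * cfEta α a i|
      ≤ 8 * |cfEta α a n| := by
  rw [← (h.summable_mul_eta hc).sum_add_tsum_nat_add n, add_sub_cancel_left]
  have hg := (hasSum_geometric_of_lt_one (by norm_num) (by norm_num : (1 / 2 : ℝ) < 1)).mul_left
    (4 * |cfEta α a n|)
  have := tsum_of_norm_bounded hg (h.abs_term_le hc n)
  rw [Real.norm_eq_abs] at this
  refine this.trans (le_of_eq ?_)
  norm_num
  ring

/-- The tail of an alternating digit series is dominated by its first term. -/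
theorem sum_sub_tsum_mem (h : LargeDigits α a) {c : ℕ → ℤ} (hc1 : ∀ i, 1 ≤ c i)
    (hc4 : ∀ i, c i ≤ 4) {n : ℕ} (hn : Odd n) :
    0 < ∑ i ∈ Finset.range n, (c i : ℝ) * cfEta α a i - ∑' i, (c i : ℝ) * cfEta α a i ∧
    ∑ i ∈ Finset.range n, (c i : ℝ) * cfEta α a i - ∑' i, (c i : ℝ) * cfEta α a i
      < 5 * |cfEta α a n| := by
  have h1 := abs_le.1 (h.abs_tsum_sub_sum_le
    (fun i => abs_le.2 ⟨by linarith [hc1 i], hc4 i⟩) (n + 1))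
  rw [Finset.sum_range_succ, h.eta_of_odd hn] at h1
  have h2 := h.mul_abs_eta_le n
  have h3 := h.abs_eta_pos n
  have h4 : (1 : ℝ) ≤ c n := by exact_mod_cast hc1 n
  have h5 : (c n : ℝ) ≤ 4 := by exact_mod_cast hc4 n
  constructor <;> nlinarith

end LargeDigits

/-! ### Primitives of the floor sequence -/

/-- A primitive of the sequence `⌊k α⌋`, `k ∈ ℤ`. -/
noncomputable def floorSum (α : ℝ) (x : ℤ) : ℤ :=
  ∑ j ∈ Finset.range x.toNat, ⌊((j : ℝ) + 1) * α⌋ - ∑ j ∈ Finset.range (-x).toNat, ⌊-(j : ℝ) * α⌋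

theorem floorSum_add_one (α : ℝ) (x : ℤ) :
    floorSum α (x + 1) = floorSum α x + ⌊((x + 1 : ℤ) : ℝ) * α⌋ := by
  rcases le_or_gt 0 x with hx | hx
  · obtain ⟨n, rfl⟩ := Int.eq_ofNat_of_zero_le hx
    have h1 : ((n : ℤ) + 1).toNat = n + 1 := by omega
    have h2 : (-((n : ℤ) + 1)).toNat = 0 := by omega
    have h3 : (-(n : ℤ)).toNat = 0 := by omega
    simp only [floorSum, h1, h2, h3, Finset.sum_range_succ, Int.toNat_natCast]
    push_cast; ring
  · obtain ⟨n, rfl⟩ : ∃ n : ℕ, x = -((n : ℤ) + 1) := ⟨(-x - 1).toNat, by omega⟩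
    have h1 : (-((n : ℤ) + 1) + 1).toNat = 0 := by omega
    have h2 : (-(-((n : ℤ) + 1) + 1)).toNat = n := by omega
    have h3 : (-((n : ℤ) + 1)).toNat = 0 := by omega
    have h4 : (-(-((n : ℤ) + 1))).toNat = n + 1 := by omega
    simp only [floorSum, h1, h2, h3, h4, Finset.sum_range_succ]
    push_cast
    rw [show -((n : ℝ) + 1) + 1 = -(n : ℝ) by ring]
    simp

/-! ### Returns to the neighbourhoods of zero -/

/-- The times `j ∈ ℤ` at which `j α` modulo `1` is in the interval between `0` and `η_i`, with its
lower endpoint and without its upper endpoint. -/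
def IsReturn (α : ℝ) (a : ℕ → ℕ) (i : ℕ) (j : ℤ) : Prop :=
  ⌊(j : ℝ) * α⌋ ≠ ⌊(j : ℝ) * α - cfEta α a i⌋

open Classical in
/-- The number of returns of level `i` in the interval between `x` and `y`, without its left
endpoint. The order of `x` and `y` does not matter. -/
noncomputable def returnCount (α : ℝ) (a : ℕ → ℕ) (i : ℕ) (x y : ℤ) : ℕ :=
  ((Finset.Ioc (min x y) (max x y)).filter (IsReturn α a i)).card

theorem returnCount_comm (α : ℝ) (a : ℕ → ℕ) (i : ℕ) (x y : ℤ) :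
    returnCount α a i x y = returnCount α a i y x := by
  rw [returnCount, returnCount, min_comm, max_comm]

theorem returnCount_add_one (α : ℝ) (a : ℕ → ℕ) (i : ℕ) {x y : ℤ} (hxy : x ≤ y)
    [Decidable (IsReturn α a i (y + 1))] :
    returnCount α a i x (y + 1)
      = returnCount α a i x y + if IsReturn α a i (y + 1) then 1 else 0 := by
  classical
  rw [returnCount, returnCount, min_eq_left hxy, max_eq_right hxy, min_eq_left (by omega),
    max_eq_right (by omega)]
  have : Finset.Ioc x (y + 1) = insert (y + 1) (Finset.Ioc x y) := by
    ext z; simp; omega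
  rw [this, Finset.filter_insert]
  split_ifs with h
  · rw [Finset.card_insert_of_notMem (by simp)]
  · rfl

namespace LargeDigits

variable {α : ℝ} {a : ℕ → ℕ}

theorem floor_sub_floor_eta (h : LargeDigits α a) (i : ℕ) (j : ℤ)
    [Decidable (IsReturn α a i j)] :
    ((⌊(j : ℝ) * α⌋ - ⌊(j : ℝ) * α - cfEta α a i⌋ : ℤ) : ZMod 2)
      = if IsReturn α a i j then 1 else 0 := by
  have hη : |cfEta α a i| < 1 := by linarith [h.abs_eta_le i, h.alpha_lt, h.alpha_pos]
  rw [abs_lt] at hη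
  have h1 := Int.floor_le ((j : ℝ) * α)
  have h2 := Int.lt_floor_add_one ((j : ℝ) * α)
  have h3 := Int.floor_le ((j : ℝ) * α - cfEta α a i)
  have h4 := Int.lt_floor_add_one ((j : ℝ) * α - cfEta α a i)
  have h5 : (⌊(j : ℝ) * α⌋ : ℝ) < ((⌊(j : ℝ) * α - cfEta α a i⌋ + 2 : ℤ) : ℝ) := by
    push_cast; linarith
  have h6 : (⌊(j : ℝ) * α - cfEta α a i⌋ : ℝ) < ((⌊(j : ℝ) * α⌋ + 2 : ℤ) : ℝ) := by
    push_cast; linarith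
  have h5 := Int.cast_lt.1 h5
  have h6 := Int.cast_lt.1 h6
  obtain e | e | e : ⌊(j : ℝ) * α⌋ = ⌊(j : ℝ) * α - cfEta α a i⌋ ∨
      ⌊(j : ℝ) * α⌋ = ⌊(j : ℝ) * α - cfEta α a i⌋ + 1 ∨
      ⌊(j : ℝ) * α⌋ = ⌊(j : ℝ) * α - cfEta α a i⌋ + -1 := by omega
  · rw [if_neg (show ¬IsReturn α a i j from not_not.2 e), e, sub_self, Int.cast_zero]
  · rw [if_pos (by rw [IsReturn, e]; omega), e, add_sub_cancel_left, Int.cast_one]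
  · rw [if_pos (by rw [IsReturn, e]; omega), e, add_sub_cancel_left]
    decide

/-- Modulo `2`, the second difference of the primitive with steps `q_i` and `y - x` counts the
returns of level `i`. -/
theorem floorSum_second_difference (h : LargeDigits α a) (i : ℕ) (x y : ℤ) :
    (floorSum α y + floorSum α (y - cfDen a i) + floorSum α x + floorSum α (x - cfDen a i) : ZMod 2)
      = (y - x : ℤ) * cfNum a i + returnCount α a i x y := by
  classical
  have key : ∀ x y : ℤ, x ≤ y →
      (floorSum α y + floorSum α (y - cfDen a i) + floorSum α x + floorSum α (x - cfDen a i) :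
        ZMod 2) = (y - x : ℤ) * cfNum a i + returnCount α a i x y := by
    intro x y hxy
    induction y, hxy using Int.leInduction with
    | base =>
      have : returnCount α a i x x = 0 := by simp [returnCount]
      rw [this]
      have e1 := CharTwo.add_self_eq_zero (floorSum α x : ZMod 2)
      have e2 := CharTwo.add_self_eq_zero (floorSum α (x - cfDen a i) : ZMod 2)
      simp only [sub_self, Int.cast_zero, zero_mul, Nat.cast_zero, add_zero]
      linear_combination e1 + e2
    | succ y hxy ih =>
      rw [returnCount_add_one α a i hxy, floorSum_add_one,
        show y + 1 - cfDen a i = y - cfDen a i + 1 by ring, floorSum_add_one,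
        show (((y - cfDen a i + 1 : ℤ) : ℝ) * α)
          = ((y + 1 : ℤ) : ℝ) * α - cfEta α a i - cfNum a i by
            simp only [cfEta]; push_cast; ring, Int.floor_sub_intCast]
      have e1 := h.floor_sub_floor_eta i (y + 1)
      have e2 := CharTwo.add_self_eq_zero
        (⌊((y + 1 : ℤ) : ℝ) * α - cfEta α a i⌋ : ZMod 2)
      have e3 := CharTwo.add_self_eq_zero (cfNum a i : ZMod 2)
      rw [Nat.cast_add, Nat.cast_ite, ← Nat.cast_one, ← Nat.cast_zero] at *
      push_cast at e1 e2 ih ⊢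
      linear_combination ih + e1 + e2 - e3
  rcases le_total x y with hxy | hxy
  · exact key x y hxy
  · have := key y x hxy
    rw [returnCount_comm]
    have e : (((y - x : ℤ)) : ZMod 2) = ((x - y : ℤ) : ZMod 2) := by
      rw [← neg_sub, Int.cast_neg, CharTwo.neg_eq]
    rw [e]
    linear_combination this

/-- Returns of level `i` are at least `q_{i+1}` apart. -/
theorem den_le_sub_of_isReturn (h : LargeDigits α a) {i : ℕ} {j j' : ℤ} (hjj' : j < j')
    (hj : IsReturn α a i j) (hj' : IsReturn α a i j') : cfDen a (i + 1) ≤ j' - j := by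
  by_contra hlt
  push Not at hlt
  have hη : |cfEta α a i| < 1 := by linarith [h.abs_eta_le i, h.alpha_lt, h.alpha_pos]
  have hfl : ∀ z : ℝ, ∀ η : ℝ, ⌊z⌋ ≠ ⌊z - η⌋ →
      ∃ r : ℤ, (0 ≤ η → z - η < r ∧ r ≤ z) ∧ (η < 0 → z < r ∧ r ≤ z - η) := by
    intro z η hne
    rcases le_or_gt 0 η with h0 | h0
    · refine ⟨⌊z⌋, fun _ => ⟨?_, Int.floor_le z⟩, fun h => by linarith⟩
      have : ⌊z - η⌋ < ⌊z⌋ :=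
        lt_of_le_of_ne (Int.floor_le_floor (by linarith)) (Ne.symm hne)
      exact Int.floor_lt.1 this
    · refine ⟨⌊z - η⌋, fun h => by linarith, fun _ => ⟨?_, Int.floor_le _⟩⟩
      have : ⌊z⌋ < ⌊z - η⌋ :=
        lt_of_le_of_ne (Int.floor_le_floor (by linarith)) hne
      exact Int.floor_lt.1 this
  obtain ⟨r, hr1, hr2⟩ := hfl _ _ hj
  obtain ⟨r', hr1', hr2'⟩ := hfl _ _ hj'
  have hb := h.abs_eta_le_abs_sub i (k := j' - j) (r := r' - r)
    (by rw [abs_of_pos (by omega)]; exact hlt) (Or.inl (by omega))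
  refine absurd hb (not_le.2 ?_)
  push_cast
  rcases le_or_gt 0 (cfEta α a i) with h0 | h0
  · obtain ⟨h1, h2⟩ := hr1 h0
    obtain ⟨h3, h4⟩ := hr1' h0
    rw [abs_of_nonneg h0, abs_lt]
    constructor <;> linarith
  · obtain ⟨h1, h2⟩ := hr2 h0
    obtain ⟨h3, h4⟩ := hr2' h0
    rw [abs_of_neg h0, abs_lt]
    constructor <;> linarith

theorem isReturn_zero (h : LargeDigits α a) {i : ℕ} (hi : Even i) : IsReturn α a i 0 := by
  have hη : |cfEta α a i| < 1 := by linarith [h.abs_eta_le i, h.alpha_lt, h.alpha_pos]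
  have h1 := h.abs_eta_pos i
  rw [IsReturn, h.eta_of_even hi]
  have : ⌊((0 : ℤ) : ℝ) * α - |cfEta α a i|⌋ = -1 := by
    rw [Int.floor_eq_iff]; push_cast; constructor <;> linarith
  rw [this]; simp

theorem isReturn_den (h : LargeDigits α a) {i : ℕ} (hi : Odd i) :
    IsReturn α a i (cfDen a i) := by
  have hη : |cfEta α a i| < 1 := by linarith [h.abs_eta_le i, h.alpha_lt, h.alpha_pos]
  have h1 := h.abs_eta_pos i
  have h2 := h.eta_of_odd hi
  have h3 : (cfDen a i : ℝ) * α = cfNum a i + cfEta α a i := by rw [cfEta]; ring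
  rw [IsReturn, h3, add_sub_cancel_right, Int.floor_intCast, Int.floor_intCast_add]
  have : ⌊cfEta α a i⌋ = -1 := by
    rw [Int.floor_eq_iff]; push_cast; constructor <;> linarith
  rw [this]; omega

end LargeDigits

/-- The return of level `i` that is closest to the time `0`. -/
def mainReturn (a : ℕ → ℕ) (i : ℕ) : ℤ := if Even i then 0 else cfDen a i

namespace LargeDigits

variable {α : ℝ} {a : ℕ → ℕ}

theorem isReturn_mainReturn (h : LargeDigits α a) (i : ℕ) : IsReturn α a i (mainReturn a i) := by
  rw [mainReturn]
  split_ifs with hi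
  · exact h.isReturn_zero hi
  · exact h.isReturn_den (Nat.not_even_iff_odd.1 hi)

theorem eq_mainReturn (h : LargeDigits α a) {i : ℕ} {j : ℤ} (hj : IsReturn α a i j)
    (h1 : mainReturn a i - cfDen a (i + 1) < j) (h2 : j < mainReturn a i + cfDen a (i + 1)) :
    j = mainReturn a i := by
  by_contra hne
  rcases lt_or_gt_of_ne hne with hlt | hlt
  · have := h.den_le_sub_of_isReturn hlt hj (h.isReturn_mainReturn i); omega
  · have := h.den_le_sub_of_isReturn hlt (h.isReturn_mainReturn i) hj; omega

/-- Close to the time `0`, the main return is the only one. -/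
theorem returnCount_eq (h : LargeDigits α a) {i : ℕ} {x y : ℤ}
    (hx1 : mainReturn a i - cfDen a (i + 1) ≤ x) (hx2 : x < mainReturn a i + cfDen a (i + 1))
    (hy1 : mainReturn a i - cfDen a (i + 1) ≤ y) (hy2 : y < mainReturn a i + cfDen a (i + 1)) :
    returnCount α a i x y
      = if min x y < mainReturn a i ∧ mainReturn a i ≤ max x y then 1 else 0 := by
  classical
  rw [returnCount]
  split_ifs with hc
  · rw [Finset.card_eq_one]
    refine ⟨mainReturn a i, ?_⟩
    ext z
    simp only [Finset.mem_filter, Finset.mem_Ioc, Finset.mem_singleton]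
    constructor
    · rintro ⟨hz, hr⟩
      exact h.eq_mainReturn hr (by omega) (by omega)
    · rintro rfl
      exact ⟨hc, h.isReturn_mainReturn i⟩
  · rw [Finset.card_eq_zero, Finset.filter_eq_empty_iff]
    intro z hz hr
    rw [Finset.mem_Ioc] at hz
    have := h.eq_mainReturn hr (by omega) (by omega)
    subst this
    exact hc hz

end LargeDigits

/-! ### Digit expansions of the endpoints of the gate -/

/-- The number `∑ c_i q_i`, summed over `i < n`. -/
def digitDen (a : ℕ → ℕ) (c : ℕ → ℤ) (n : ℕ) : ℤ := ∑ i ∈ Finset.range n, c i * cfDen a i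

/-- The number `∑ c_i p_i`, summed over `i < n`. -/
def digitNum (a : ℕ → ℕ) (c : ℕ → ℤ) (n : ℕ) : ℤ := ∑ i ∈ Finset.range n, c i * cfNum a i

/-- The sum of the series `∑ c_i η_i`. -/
noncomputable def digitPoint (α : ℝ) (a : ℕ → ℕ) (c : ℕ → ℤ) : ℝ :=
  ∑' i, (c i : ℝ) * cfEta α a i

theorem digitDen_succ (a : ℕ → ℕ) (c : ℕ → ℤ) (n : ℕ) :
    digitDen a c (n + 1) = digitDen a c n + c n * cfDen a n := Finset.sum_range_succ _ _

theorem digitDen_zero (a : ℕ → ℕ) (c : ℕ → ℤ) : digitDen a c 0 = 0 := rfl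

theorem sum_digit_eta (α : ℝ) (a : ℕ → ℕ) (c : ℕ → ℤ) (n : ℕ) :
    ∑ i ∈ Finset.range n, (c i : ℝ) * cfEta α a i = digitDen a c n * α - digitNum a c n := by
  rw [digitDen, digitNum]
  push_cast
  rw [Finset.sum_mul, ← Finset.sum_sub_distrib]
  exact Finset.sum_congr rfl fun i _ => by rw [cfEta]; ring

namespace LargeDigits

variable {α : ℝ} {a : ℕ → ℕ} {c : ℕ → ℤ}

/-- The partial sums `∑ c_i q_i` are of the order of their last term. -/
theorem digitDen_bounds (h : LargeDigits α a) (hc1 : ∀ i, 1 ≤ c i) (hc4 : ∀ i, c i ≤ 4) (n : ℕ) :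
    0 ≤ digitDen a c n ∧ 50 * digitDen a c n ≤ cfDen a n ∧
      cfDen a n ≤ digitDen a c (n + 1) ∧ digitDen a c (n + 1) ≤ 5 * cfDen a n := by
  have step : ∀ n, 0 ≤ digitDen a c n → 50 * digitDen a c n ≤ cfDen a n →
      cfDen a n ≤ digitDen a c (n + 1) ∧ digitDen a c (n + 1) ≤ 5 * cfDen a n := by
    intro n h0 h1
    rw [digitDen_succ]
    have := h.den_pos n
    constructor <;> nlinarith [hc1 n, hc4 n]
  have key : ∀ n, 0 ≤ digitDen a c n ∧ 50 * digitDen a c n ≤ cfDen a n := by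
    intro n
    induction n with
    | zero => simp [digitDen_zero, cfDen]
    | succ n ih =>
      have h1 := step n ih.1 ih.2
      have h2 := h.den_pos n
      have h3 := h.mul_den_le n
      constructor <;> linarith
  exact ⟨(key n).1, (key n).2, step n (key n).1 (key n).2⟩

/-- A partial sum of the expansion is reached by an early point of the orbit, and no other early
point of the orbit is close enough to it to be separated from it by the full sum. -/
theorem floor_sub_digitPoint (h : LargeDigits α a) (hc1 : ∀ i, 1 ≤ c i) (hc4 : ∀ i, c i ≤ 4)
    {n : ℕ} (hn : Odd n) {k : ℤ} (hk0 : 0 ≤ k) (hk : k < cfDen a n) :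
    ⌊(k : ℝ) * α - digitPoint α a c⌋ = ⌊((k - digitDen a c n : ℤ) : ℝ) * α⌋ + digitNum a c n ∧
    ∀ r : ℤ, (k : ℝ) * α - digitPoint α a c ≠ r := by
  obtain ⟨N, rfl⟩ : ∃ N, n = N + 1 := ⟨n - 1, by have := hn.pos; omega⟩
  obtain ⟨hδ0, hδ1⟩ := h.sum_sub_tsum_mem hc1 hc4 hn
  rw [sum_digit_eta] at hδ0 hδ1
  rw [digitPoint]
  set A := ∑' i, (c i : ℝ) * cfEta α a i
  obtain ⟨hu0, -, hu1, hu2⟩ := h.digitDen_bounds hc1 hc4 N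
  set u := digitDen a c (N + 1)
  set v := digitNum a c (N + 1)
  have hq := h.den_pos N
  have hq' := h.mul_den_le N
  have hη := h.mul_abs_eta_le N
  have hη' := h.abs_eta_pos N
  have hgap : ∀ r : ℤ, ((k - u : ℤ) : ℝ) * α < r → (k : ℝ) * α - A - v < r := by
    intro r hr
    by_contra hle
    push Not at hle
    push_cast at hr
    have hne : k - u ≠ 0 ∨ r ≠ 0 := by
      by_contra hcon
      push Not at hcon
      have e : (k : ℝ) - u = 0 := by exact_mod_cast hcon.1
      rw [e, hcon.2] at hr
      simp at hr
    have := h.abs_eta_le_abs_sub N (k := k - u) (r := r)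
      (by rw [abs_lt]; constructor <;> linarith) hne
    refine absurd this (not_le.2 ?_)
    rw [abs_lt]
    push_cast
    constructor <;> linarith
  constructor
  · rw [← Int.sub_eq_iff_eq_add, ← Int.floor_sub_intCast]
    apply le_antisymm
    · by_contra hlt
      push Not at hlt
      have := hgap _ (Int.floor_lt.1 hlt)
      exact absurd (Int.floor_le ((k : ℝ) * α - A - v)) (not_le.2 this)
    · apply Int.floor_le_floor
      push_cast; linarith
  · intro r hr
    have := hgap (r - v) (by push_cast; linarith)
    push_cast at this
    linarith

end LargeDigits

/-- The digits of the lower endpoint of the gate: `2` at the even places, and `3` or `2` at the odd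
places, according to whether the place is active. -/
def lowDigit (J : ℕ → Prop) [DecidablePred J] (i : ℕ) : ℤ :=
  if Even i then 2 else if J i then 3 else 2

/-- The digits of the upper endpoint of the gate: `4` at the even places, and `1` or `2` at the odd
places, according to whether the place is active. -/
def highDigit (J : ℕ → Prop) [DecidablePred J] (i : ℕ) : ℤ :=
  if Even i then 4 else if J i then 1 else 2

/-- The number of returns that level `i` contributes to the parity of the number of gate crossings
up to the `K`-th crossing. The windows come from pairing the `c_i + c'_i` first differences of the
primitive `floorSum`, taken with step `q_i`, that distinguish the partial sums of length `i + 1` from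
those of length `i`. Differences are paired across the two endpoints as far as possible, since such
windows are short, and the remaining two, if any, are paired with each other. -/
noncomputable def levelCount (α : ℝ) (a : ℕ → ℕ) (J : ℕ → Prop) [DecidablePred J] (i : ℕ)
    (K : ℤ) : ℕ :=
  let q := cfDen a i
  let x := K - digitDen a (lowDigit J) i
  let x' := K - digitDen a (highDigit J) i
  if Even i then
    returnCount α a i (x' - 3 * q) (x' - 2 * q) + returnCount α a i x x' +
      returnCount α a i (x - q) (x' - q)
  else if J i then returnCount α a i (x - 2 * q) (x - q) + returnCount α a i x x'
  else returnCount α a i x x' + returnCount α a i (x - q) (x' - q)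

/-- Whether the `k`-th crossing of a right edge is through a gate (`1`) or not (`0`). -/
noncomputable def gateCrossing (α : ℝ) (a : ℕ → ℕ) (J : ℕ → Prop) [DecidablePred J] (k : ℤ) : ℤ :=
  ⌊(k : ℝ) * α - digitPoint α a (lowDigit J)⌋ - ⌊(k : ℝ) * α - digitPoint α a (highDigit J)⌋

/-- The number of gate crossings among the first `n` crossings. -/
noncomputable def gateCount (α : ℝ) (a : ℕ → ℕ) (J : ℕ → Prop) [DecidablePred J] (n : ℕ) : ℤ :=
  ∑ k ∈ Finset.range n, gateCrossing α a J (k + 1)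

section Parity

variable {α : ℝ} {a : ℕ → ℕ} {J : ℕ → Prop} [DecidablePred J]

theorem one_le_lowDigit (i : ℕ) : 1 ≤ lowDigit J i := by unfold lowDigit; split_ifs <;> norm_num
theorem lowDigit_le (i : ℕ) : lowDigit J i ≤ 4 := by unfold lowDigit; split_ifs <;> norm_num
theorem one_le_highDigit (i : ℕ) : 1 ≤ highDigit J i := by
  unfold highDigit; split_ifs <;> norm_num
theorem highDigit_le (i : ℕ) : highDigit J i ≤ 4 := by unfold highDigit; split_ifs <;> norm_num

theorem lowDigit_cast_eq (i : ℕ) : (lowDigit J i : ZMod 2) = highDigit J i := by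
  unfold lowDigit highDigit; split_ifs <;> decide

theorem digitDen_cast_eq (n : ℕ) :
    (digitDen a (lowDigit J) n : ZMod 2) = digitDen a (highDigit J) n := by
  simp [digitDen, lowDigit_cast_eq]

theorem digitNum_cast_eq (n : ℕ) :
    (digitNum a (lowDigit J) n : ZMod 2) = digitNum a (highDigit J) n := by
  simp [digitNum, lowDigit_cast_eq]

namespace LargeDigits

/-- The contribution of one further digit to the primitive of the gate crossings. -/
theorem exists_level_step (h : LargeDigits α a) (i : ℕ) : ∃ κ : ZMod 2, ∀ K : ℤ,
    (floorSum α (K - digitDen a (lowDigit J) (i + 1))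
      + floorSum α (K - digitDen a (highDigit J) (i + 1)) : ZMod 2)
    = floorSum α (K - digitDen a (lowDigit J) i) + floorSum α (K - digitDen a (highDigit J) i)
      + κ + levelCount α a J i K := by
  have two : (2 : ZMod 2) = 0 := rfl
  -- in each case, `s1`, `s2` and `s3` are the pairs of differences that make up `levelCount`
  have hs := h.floorSum_second_difference i
  by_cases hi : Even i
  · refine ⟨cfDen a i * cfNum a i, fun K => ?_⟩
    rw [digitDen_succ, digitDen_succ]
    have e := digitDen_cast_eq (a := a) (J := J) i
    simp only [levelCount, lowDigit, highDigit, if_pos hi] at e ⊢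
    set q := cfDen a i
    generalize digitDen a _ i = u at *
    generalize digitDen a _ i = u' at *
    have s1 := hs (K - u) (K - u')
    have s2 := hs (K - u - q) (K - u' - q)
    have s3 := hs (K - u' - 3 * q) (K - u' - 2 * q)
    rw [show K - u - q - q = K - (u + 2 * q) by ring,
      show K - u' - q - q = K - u' - 2 * q by ring] at s2
    rw [show K - u' - 2 * q - q = K - u' - 3 * q by ring,
      show K - u' - 3 * q - q = K - (u' + 4 * q) by ring] at s3
    push_cast at s1 s2 s3 ⊢
    linear_combination s1 + s2 + s3 + 2 * cfNum a i * e - (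
      (floorSum α (K - u) : ZMod 2) + floorSum α (K - u')
      + floorSum α (K - u - q) + floorSum α (K - u' - q)
      + floorSum α (K - u' - 2 * q) + floorSum α (K - u' - 3 * q)) * two
  · by_cases hJ : J i
    · refine ⟨cfDen a i * cfNum a i, fun K => ?_⟩
      rw [digitDen_succ, digitDen_succ]
      have e := digitDen_cast_eq (a := a) (J := J) i
      simp only [levelCount, lowDigit, highDigit, if_neg hi, if_pos hJ] at e ⊢
      set q := cfDen a i
      generalize digitDen a _ i = u at *
      generalize digitDen a _ i = u' at *
      have s1 := hs (K - u) (K - u')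
      have s2 := hs (K - u - 2 * q) (K - u - q)
      rw [show K - u - q - q = K - u - 2 * q by ring,
        show K - u - 2 * q - q = K - (u + 3 * q) by ring] at s2
      rw [show K - u' - q = K - (u' + 1 * q) by ring] at s1
      push_cast at s1 s2 ⊢
      linear_combination s1 + s2 + cfNum a i * e - (
        (floorSum α (K - u) : ZMod 2) + floorSum α (K - u')
        + floorSum α (K - u - q) + floorSum α (K - u - 2 * q)) * two
    · refine ⟨0, fun K => ?_⟩
      rw [digitDen_succ, digitDen_succ]
      have e := digitDen_cast_eq (a := a) (J := J) i
      simp only [levelCount, lowDigit, highDigit, if_neg hi, if_neg hJ] at e ⊢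
      set q := cfDen a i
      generalize digitDen a _ i = u at *
      generalize digitDen a _ i = u' at *
      have s1 := hs (K - u) (K - u')
      have s2 := hs (K - u - q) (K - u' - q)
      rw [show K - u - q - q = K - (u + 2 * q) by ring,
        show K - u' - q - q = K - (u' + 2 * q) by ring] at s2
      push_cast at s1 s2 ⊢
      linear_combination s1 + s2 + 2 * cfNum a i * e - (
        (floorSum α (K - u) : ZMod 2) + floorSum α (K - u')
        + floorSum α (K - u - q) + floorSum α (K - u' - q)) * two

theorem mainReturn_bounds (h : LargeDigits α a) (i : ℕ) :
    0 ≤ mainReturn a i ∧ mainReturn a i ≤ cfDen a i := by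
  have := h.den_pos i
  unfold mainReturn; split_ifs <;> constructor <;> omega

/-- At the time `0` all windows are on the negative side, where there are no returns close by. -/
theorem levelCount_zero (h : LargeDigits α a) (i : ℕ) : levelCount α a J i 0 = 0 := by
  obtain ⟨hm0, hm1⟩ := h.mainReturn_bounds i
  have hq := h.den_pos i
  have hq' := h.mul_den_le i
  obtain ⟨u0, u1, -⟩ := h.digitDen_bounds (one_le_lowDigit (J := J)) lowDigit_le i
  obtain ⟨v0, v1, -⟩ := h.digitDen_bounds (one_le_highDigit (J := J)) highDigit_le i
  have hpos : (0 < digitDen a (lowDigit J) i ∧ 0 < digitDen a (highDigit J) i) ∨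
      (digitDen a (lowDigit J) i = 0 ∧ digitDen a (highDigit J) i = 0) := by
    cases i with
    | zero => exact Or.inr ⟨rfl, rfl⟩
    | succ i =>
      have := h.den_pos i
      have h1 := (h.digitDen_bounds (one_le_lowDigit (J := J)) lowDigit_le i).2.2.1
      have h2 := (h.digitDen_bounds (one_le_highDigit (J := J)) highDigit_le i).2.2.1
      exact Or.inl ⟨by omega, by omega⟩
  have hzero : ∀ x y : ℤ, -(5 * cfDen a i) ≤ x → -(5 * cfDen a i) ≤ y →
      ((x < 0 ∧ y < 0) ∨ x = y) → returnCount α a i x y = 0 := by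
    intro x y hx hy hxy
    by_cases e : x = y
    · subst e; simp [returnCount]
    · have : x < 0 ∧ y < 0 := hxy.resolve_right e
      rw [h.returnCount_eq (by omega) (by omega) (by omega) (by omega), if_neg]
      omega
  simp only [levelCount, zero_sub]
  split_ifs
  · rw [hzero _ _ (by omega) (by omega) (by omega), hzero _ _ (by omega) (by omega) (by omega),
      hzero _ _ (by omega) (by omega) (by omega)]
  · rw [hzero _ _ (by omega) (by omega) (by omega), hzero _ _ (by omega) (by omega) (by omega)]
  · rw [hzero _ _ (by omega) (by omega) (by omega), hzero _ _ (by omega) (by omega) (by omega)]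

theorem sum_levelCount (h : LargeDigits α a) (n : ℕ) (K : ℤ) :
    (∑ i ∈ Finset.range n, (levelCount α a J i K : ZMod 2))
    = floorSum α (K - digitDen a (lowDigit J) n) + floorSum α (K - digitDen a (highDigit J) n)
      + floorSum α (0 - digitDen a (lowDigit J) n)
      + floorSum α (0 - digitDen a (highDigit J) n) := by
  have two : (2 : ZMod 2) = 0 := rfl
  induction n with
  | zero =>
    simp only [Finset.range_zero, Finset.sum_empty, digitDen_zero]
    linear_combination -((floorSum α (K - 0) : ZMod 2) + floorSum α (0 - 0)) * two
  | succ n ih =>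
    obtain ⟨κ, hκ⟩ := h.exists_level_step (J := J) n
    have h1 := hκ K
    have h2 := hκ 0
    rw [h.levelCount_zero n] at h2
    rw [Finset.sum_range_succ, ih]
    push_cast at h1 h2 ⊢
    linear_combination -h1 - h2 - κ * two

/-- The parity of the number of gate crossings is determined by the levels, as long as the orbit
cannot resolve the tails of the expansions of the endpoints of the gate. -/
theorem gateCount_cast_eq (h : LargeDigits α a) {n : ℕ} (hn : Odd n) {K : ℕ}
    (hK : (K : ℤ) < cfDen a n) :
    (gateCount α a J K : ZMod 2) = ∑ i ∈ Finset.range n, (levelCount α a J i K : ZMod 2) := by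
  have two : (2 : ZMod 2) = 0 := rfl
  rw [h.sum_levelCount]
  induction K with
  | zero =>
    simp only [gateCount, Finset.range_zero, Finset.sum_empty, Nat.cast_zero, Int.cast_zero]
    linear_combination -((floorSum α (0 - digitDen a (lowDigit J) n) : ZMod 2)
      + floorSum α (0 - digitDen a (highDigit J) n)) * two
  | succ K ih =>
    have ih := ih (by push_cast at hK; omega)
    rw [gateCount, Finset.sum_range_succ, ← gateCount, gateCrossing]
    have h1 := (h.floor_sub_digitPoint (one_le_lowDigit (J := J)) lowDigit_le hn
      (k := (K : ℤ) + 1) (by omega) (by push_cast at hK; omega)).1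
    have h2 := (h.floor_sub_digitPoint (one_le_highDigit (J := J)) highDigit_le hn
      (k := (K : ℤ) + 1) (by omega) (by push_cast at hK; omega)).1
    rw [h1, h2, Nat.cast_succ,
      show (K : ℤ) + 1 - digitDen a (lowDigit J) n = K - digitDen a (lowDigit J) n + 1 by ring,
      show (K : ℤ) + 1 - digitDen a (highDigit J) n = K - digitDen a (highDigit J) n + 1 by ring,
      floorSum_add_one, floorSum_add_one]
    have e := digitNum_cast_eq (a := a) (J := J) n
    rw [Int.cast_add, ih]
    push_cast
    generalize ⌊((K : ℝ) - (digitDen a (highDigit J) n : ℝ) + 1) * α⌋ = z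
    linear_combination e - z * two

end LargeDigits

/-! ### The itinerary -/

/-- The square that is visited after the `K`-th crossing. For `K < 0` this is the left square. -/
noncomputable def itinerary (α : ℝ) (a : ℕ → ℕ) (J : ℕ → Prop) [DecidablePred J] (K : ℤ) : Side :=
  if Even (gateCount α a J K.toNat) then Side.left else Side.right

theorem itinerary_zero : itinerary α a J 0 = Side.left := by simp [itinerary, gateCount]

namespace LargeDigits

theorem nat_lt_den (h : LargeDigits α a) (n : ℕ) : (n : ℤ) < cfDen a n := by
  induction n with
  | zero => simp [cfDen]
  | succ n ih => have := h.mul_den_le n; push_cast; omega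

theorem exists_odd_lt_den (h : LargeDigits α a) (k : ℤ) : ∃ n, Odd n ∧ k < cfDen a n := by
  refine ⟨2 * k.toNat + 1, ⟨_, rfl⟩, ?_⟩
  have := h.nat_lt_den (2 * k.toNat + 1)
  omega

theorem obeysGates_itinerary (h : LargeDigits α a) {b y₀ : ℝ}
    (hb : b = digitPoint α a (highDigit J) - digitPoint α a (lowDigit J))
    (hy : y₀ = 1 - digitPoint α a (lowDigit J)) (hb0 : 0 < b)
    (hA : 0 < digitPoint α a (lowDigit J)) (hB : digitPoint α a (highDigit J) < 1) :
    ObeysGates b α y₀ (itinerary α a J) := by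
  subst hy hb
  have hcross : ∀ k : ℤ, 0 < k →
      gateCount α a J k.toNat = gateCount α a J (k - 1).toNat + gateCrossing α a J k := by
    intro k hk
    have h1 : k.toNat = (k - 1).toNat + 1 := by omega
    rw [h1, gateCount, Finset.sum_range_succ, ← gateCount]
    congr 2
    omega
  have hne : ∀ k : ℤ, 0 ≤ k → (∀ r : ℤ, (k : ℝ) * α - digitPoint α a (lowDigit J) ≠ r) ∧
      ∀ r : ℤ, (k : ℝ) * α - digitPoint α a (highDigit J) ≠ r := by
    intro k hk
    obtain ⟨n, hn, hkn⟩ := h.exists_odd_lt_den k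
    exact ⟨(h.floor_sub_digitPoint one_le_lowDigit lowDigit_le hn hk hkn).2,
      (h.floor_sub_digitPoint one_le_highDigit highDigit_le hn hk hkn).2⟩
  constructor
  · intro k j hk h1 h2
    have hk' : 0 < k := by
      refine lt_of_le_of_ne hk ?_
      rintro rfl
      have e1 : (0 : ℝ) < ((1 - j : ℤ) : ℝ) := by push_cast at h1 ⊢; linarith
      have e2 : ((1 - j : ℤ) : ℝ) < ((1 : ℤ) : ℝ) := by push_cast at h2 ⊢; linarith
      have e1 : 0 < 1 - j := by exact_mod_cast e1
      have e2 : 1 - j < 1 := by exact_mod_cast e2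
      omega
    have hc : gateCrossing α a J k = 1 := by
      have e1 : ⌊(k : ℝ) * α - digitPoint α a (lowDigit J)⌋ = j - 1 := by
        rw [Int.floor_eq_iff]; push_cast; constructor <;> linarith
      have e2 : ⌊(k : ℝ) * α - digitPoint α a (highDigit J)⌋ = j - 2 := by
        have := lt_of_le_of_ne
          (show (k : ℝ) * α - digitPoint α a (highDigit J) ≤ ((j - 1 : ℤ) : ℝ) by
            push_cast; linarith) ((hne k hk).2 (j - 1))
        push_cast at this
        rw [Int.floor_eq_iff]; push_cast; constructor <;> linarith
      rw [gateCrossing, e1, e2]; ring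
    rw [itinerary, itinerary, hcross k hk', hc]
    generalize gateCount α a J (k - 1).toNat = z
    by_cases he : Even z <;> simp [-Int.not_even_iff_odd, he, Side.other]
  · intro k j hk h1 h2
    rcases hk.eq_or_lt with rfl | hk'
    · rfl
    · have hc : gateCrossing α a J k = 0 := by
        have e1 : ⌊(k : ℝ) * α - digitPoint α a (lowDigit J)⌋ = j - 1 := by
          have := lt_of_le_of_ne
            (show (k : ℝ) * α - digitPoint α a (lowDigit J) ≤ (j : ℤ) by linarith)
            ((hne k hk).1 j)
          rw [Int.floor_eq_iff]; push_cast; constructor <;> linarith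
        have e2 : ⌊(k : ℝ) * α - digitPoint α a (highDigit J)⌋ = j - 1 := by
          rw [Int.floor_eq_iff]; push_cast; constructor <;> linarith
        rw [gateCrossing, e1, e2]; ring
      rw [itinerary, itinerary, hcross k hk', hc, add_zero]

end LargeDigits

end Parity

/-! ### Counting returns -/

namespace LargeDigits

variable {α : ℝ} {a : ℕ → ℕ} {J : ℕ → Prop} [DecidablePred J]

open Classical in
theorem card_isReturn_mul_le (h : LargeDigits α a) (i : ℕ) (Y : ℤ) {L : ℤ} (hL : 0 ≤ L) :
    (((Finset.Ico Y (Y + L)).filter (IsReturn α a i)).card : ℤ) * cfDen a (i + 1)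
      ≤ L + cfDen a (i + 1) := by
  set q := cfDen a (i + 1)
  have hq : 0 < q := h.den_pos (i + 1)
  have hcard : ((Finset.Ico Y (Y + L)).filter (IsReturn α a i)).card
      ≤ (Finset.Icc 0 (L / q)).card := by
    refine Finset.card_le_card_of_injOn (fun j => (j - Y) / q) ?_ ?_
    · intro j hj
      rw [Finset.mem_coe, Finset.mem_filter, Finset.mem_Ico] at hj
      rw [Finset.mem_coe, Finset.mem_Icc]
      exact ⟨Int.ediv_nonneg (by omega) hq.le, Int.ediv_le_ediv hq (by omega)⟩
    · have key : ∀ j j' : ℤ, IsReturn α a i j → IsReturn α a i j' → j < j' →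
          (j - Y) / q ≠ (j' - Y) / q := by
        intro j j' hj hj' hlt he
        have h1 := h.den_le_sub_of_isReturn hlt hj hj'
        have h2 := Int.mul_ediv_add_emod (j - Y) q
        have h3 := Int.mul_ediv_add_emod (j' - Y) q
        have h4 := Int.emod_nonneg (j - Y) hq.ne'
        have h5 := Int.emod_lt_of_pos (j' - Y) hq
        rw [he] at h2
        have h1 : q ≤ j' - j := h1
        linarith
      intro j hj j' hj' he
      rw [Finset.mem_coe, Finset.mem_filter] at hj hj'
      by_contra hne
      rcases lt_or_gt_of_ne hne with hlt | hlt
      · exact key j j' hj.2 hj'.2 hlt he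
      · exact key j' j hj'.2 hj.2 hlt he.symm
  rw [Int.card_Icc] at hcard
  have h0 : 0 ≤ L / q := Int.ediv_nonneg hL hq.le
  have h1 : (((Finset.Ico Y (Y + L)).filter (IsReturn α a i)).card : ℤ) ≤ L / q + 1 := by omega
  have h2 : L / q * q ≤ L := Int.ediv_mul_le _ hq.ne'
  nlinarith

theorem sum_returnCount_le (h : LargeDigits α a) (i : ℕ) (s t X : ℤ) {L : ℤ} (hL : 0 ≤ L)
    {l : ℤ} (hl : |t - s| ≤ l) :
    ∑ K ∈ Finset.Ico X (X + L), (returnCount α a i (K - s) (K - t) : ℝ)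
      ≤ l * (L / cfDen a (i + 1) + 1) := by
  classical
  wlog hst : s ≤ t generalizing s t
  · have := this t s (by rwa [abs_sub_comm]) (by omega)
    simpa only [returnCount_comm] using this
  have hq : (0 : ℝ) < cfDen a (i + 1) := by exact_mod_cast h.den_pos (i + 1)
  have hLR : (0 : ℝ) ≤ L := by exact_mod_cast hL
  have hrc : ∀ K : ℤ, (returnCount α a i (K - s) (K - t) : ℝ)
      = ∑ e ∈ Finset.Ico s t, if IsReturn α a i (K - e) then (1 : ℝ) else 0 := by
    intro K
    rw [Finset.sum_boole, returnCount, min_eq_right (by omega), max_eq_left (by omega)]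
    congr 1
    refine Finset.card_bij (fun j _ => K - j) ?_ ?_ ?_
    · intro j hj
      simp only [Finset.mem_filter, Finset.mem_Ioc, Finset.mem_Ico, sub_sub_cancel] at hj ⊢
      exact ⟨by omega, hj.2⟩
    · intro j _ j' _ he; omega
    · intro e he
      simp only [Finset.mem_filter, Finset.mem_Ioc, Finset.mem_Ico] at he ⊢
      exact ⟨K - e, ⟨by omega, he.2⟩, by omega⟩
  simp only [hrc]
  rw [Finset.sum_comm]
  have hin : ∀ e ∈ Finset.Ico s t, ∑ K ∈ Finset.Ico X (X + L),
      (if IsReturn α a i (K - e) then (1 : ℝ) else 0) ≤ L / cfDen a (i + 1) + 1 := by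
    intro e _
    rw [Finset.sum_boole]
    have hc : ((Finset.Ico X (X + L)).filter fun K => IsReturn α a i (K - e)).card
        = ((Finset.Ico (X - e) (X - e + L)).filter (IsReturn α a i)).card := by
      refine Finset.card_bij (fun j _ => j - e) ?_ ?_ ?_
      · intro j hj
        simp only [Finset.mem_filter, Finset.mem_Ico] at hj ⊢
        exact ⟨by omega, hj.2⟩
      · intro j _ j' _ he; omega
      · intro j hj
        simp only [Finset.mem_filter, Finset.mem_Ico] at hj ⊢
        exact ⟨j + e, ⟨by omega, by rw [add_sub_cancel_right]; exact hj.2⟩, by omega⟩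
    rw [hc, div_add_one hq.ne', le_div_iff₀ hq]
    exact_mod_cast h.card_isReturn_mul_le i (X - e) hL
  refine (Finset.sum_le_card_nsmul _ _ _ hin).trans ?_
  rw [nsmul_eq_mul]
  refine mul_le_mul_of_nonneg_right ?_ (by positivity)
  rw [Int.card_Ico]
  rw [abs_of_nonneg (by omega)] at hl
  have : ((t - s).toNat : ℤ) ≤ l := by omega
  exact_mod_cast this

theorem digit_pos (h : LargeDigits α a) (i : ℕ) : (0 : ℝ) < a i := by
  have := h.large i
  exact_mod_cast (by omega : 0 < a i)

theorem den_le_div (h : LargeDigits α a) (i : ℕ) {L : ℝ} (hL : cfDen a (i + 1) ≤ L) :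
    (cfDen a i : ℝ) ≤ L * (1 / a i) := by
  rw [mul_one_div, le_div_iff₀ (h.digit_pos i)]
  have : ((a i * cfDen a i : ℤ) : ℝ) ≤ cfDen a (i + 1) := by exact_mod_cast h.digit_mul_den_le i
  push_cast at this
  linarith

theorem abs_offset_sub_le (h : LargeDigits α a) (i : ℕ) :
    50 * |digitDen a (highDigit J) i - digitDen a (lowDigit J) i| ≤ cfDen a i ∧
    |digitDen a (highDigit J) (i + 1) - digitDen a (lowDigit J) (i + 1)| ≤ 5 * cfDen a i := by
  obtain ⟨u0, u1, u2, u3⟩ := h.digitDen_bounds (one_le_lowDigit (J := J)) lowDigit_le i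
  obtain ⟨v0, v1, v2, v3⟩ := h.digitDen_bounds (one_le_highDigit (J := J)) highDigit_le i
  have := h.den_pos i
  constructor
  · rcases abs_cases (digitDen a (highDigit J) i - digitDen a (lowDigit J) i) with e | e <;> omega
  · rw [abs_le]; constructor <;> omega

/-- Over times that are long in comparison with a level, the level contributes a small
proportion. -/
theorem sum_levelCount_le (h : LargeDigits α a) (i : ℕ) (X : ℤ) {L : ℤ}
    (hL : cfDen a (i + 1) ≤ L) :
    ∑ K ∈ Finset.Ico X (X + L), (levelCount α a J i K : ℝ) ≤ 4 * L * (1 / a i) := by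
  have hq := h.den_pos i
  have hq1 := h.den_pos (i + 1)
  have hL0 : 0 ≤ L := by omega
  have hd := (h.abs_offset_sub_le (J := J) i).1
  set q := cfDen a i with hqdef
  set u := digitDen a (lowDigit J) i
  set u' := digitDen a (highDigit J) i
  set q' := cfDen a (i + 1) with hqdef'
  have hqR : (0 : ℝ) < q := by exact_mod_cast hq
  have hq1R : (0 : ℝ) < q' := by exact_mod_cast hq1
  have hLR : (q' : ℝ) ≤ L := by exact_mod_cast hL
  have hdR : 50 * ((|u' - u| : ℤ) : ℝ) ≤ q := by exact_mod_cast hd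
  have s1 := h.sum_returnCount_le i u u' X hL0 le_rfl
  have s2 := h.sum_returnCount_le i (u + q) (u' + q) X hL0 (l := |u' - u|)
    (by rw [add_sub_add_right_eq_sub])
  have s3 := h.sum_returnCount_le i (u' + 3 * q) (u' + 2 * q) X hL0 (l := q)
    (by rw [abs_le]; constructor <;> linarith)
  have s4 := h.sum_returnCount_le i (u + 2 * q) (u + q) X hL0 (l := q)
    (by rw [abs_le]; constructor <;> linarith)
  have hmain : ∑ K ∈ Finset.Ico X (X + L), (levelCount α a J i K : ℝ)
      ≤ 2 * q * (L / q' + 1) := by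
    have hF : (0 : ℝ) ≤ L / q' + 1 := by have : (0 : ℝ) ≤ L := by linarith
                                         positivity
    have hF' := mul_le_mul_of_nonneg_right hdR hF
    simp only [← sub_sub] at s1 s2 s3 s4
    rw [← hqdef'] at s1 s2 s3 s4
    have hqF : 0 ≤ q * (L / q' + 1 : ℝ) := by positivity
    simp only [levelCount]
    split_ifs <;> push_cast <;> simp only [Finset.sum_add_distrib] <;> linarith
  refine hmain.trans ?_
  have h1 := h.den_le_div i (L := L) hLR
  have h2 := h.den_le_div i (L := q') le_rfl
  have h3 : q * ((L : ℝ) / q') ≤ L * (1 / a i) := by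
    rw [mul_div_assoc', div_le_iff₀ hq1R]
    have : (0 : ℝ) ≤ L := by linarith
    nlinarith
  linarith

end LargeDigits

/-! ### The itinerary on a block of times -/

/-- For the times up to `q_{m+1}` at which the lower levels do not contribute, and away from the
first few multiples of `q_m`, the itinerary is in the right square exactly from `r q_m` to
`(r + 1) q_m`. The margin after the multiples of `q_m` covers the displacement of the windows of level
`m` by the lower digits, which is at most `5 q_{m-1}`. -/
def Resonant (α : ℝ) (a : ℕ → ℕ) (J : ℕ → Prop) [DecidablePred J] (m : ℕ) (r : ℤ) : Prop :=
  ∀ K : ℤ, 10 * cfDen a (m - 1) ≤ K → K < cfDen a (m + 1) →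
    (K < cfDen a m ∨ cfDen a m + 10 * cfDen a (m - 1) ≤ K) →
    (K < 2 * cfDen a m ∨ 2 * cfDen a m + 10 * cfDen a (m - 1) ≤ K) →
    (K < 3 * cfDen a m ∨ 3 * cfDen a m + 10 * cfDen a (m - 1) ≤ K) →
    (∀ i < m, levelCount α a J i K = 0) →
    itinerary α a J K = if r * cfDen a m ≤ K ∧ K < (r + 1) * cfDen a m
      then Side.right else Side.left

theorem side_of_parity_three (P Q R S : Prop) [Decidable P] [Decidable Q] [Decidable R]
    [Decidable S] (hQ : ¬Q) (hR : ¬R) (h : S ↔ P) :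
    (if Even ((if P then 1 else 0) + (if Q then 1 else 0) + (if R then 1 else 0)) then Side.left
      else Side.right) = if S then Side.right else Side.left := by
  by_cases hP : P <;> simp_all

theorem side_of_parity_five (P Q R S T U : Prop) [Decidable P] [Decidable Q] [Decidable R]
    [Decidable S] [Decidable T] [Decidable U] (hQ : ¬Q) (hR : ¬R) (hT : ¬T) (h : U ↔ ¬(P ↔ S)) :
    (if Even ((if P then 1 else 0) + (if Q then 1 else 0) + ((if R then 1 else 0)
        + (if S then 1 else 0) + (if T then 1 else 0))) then Side.left
      else Side.right) = if U then Side.right else Side.left := by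
  by_cases hP : P <;> by_cases hS : S <;> simp_all

theorem one_div_digit_nonneg (a : ℕ → ℕ) (i : ℕ) : 0 ≤ 1 / (a i : ℝ) := by positivity

theorem one_div_digit_le {a : ℕ → ℕ} {s : ℝ}
    (hs : ∀ n, ∑ i ∈ Finset.range n, 1 / (a i : ℝ) ≤ s) (i : ℕ) :
    1 / (a i : ℝ) ≤ s :=
  (Finset.single_le_sum (f := fun i => 1 / (a i : ℝ)) (fun i _ => one_div_digit_nonneg a i)
    (Finset.self_mem_range_succ i)).trans (hs (i + 1))

namespace LargeDigits

variable {α : ℝ} {a : ℕ → ℕ} {J : ℕ → Prop} [DecidablePred J]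

theorem itinerary_eq (h : LargeDigits α a) {n : ℕ} (hn : Odd n) {K : ℤ} (hK0 : 0 ≤ K)
    (hK : K < cfDen a n) :
    itinerary α a J K
      = if Even (∑ i ∈ Finset.range n, levelCount α a J i K) then Side.left else Side.right := by
  obtain ⟨K, rfl⟩ := Int.eq_ofNat_of_zero_le hK0
  have h1 := h.gateCount_cast_eq (J := J) hn hK
  have : Even (gateCount α a J K) ↔ Even (∑ i ∈ Finset.range n, levelCount α a J i K) := by
    rw [← ZMod.intCast_eq_zero_iff_even, ← ZMod.natCast_eq_zero_iff_even, h1, Nat.cast_sum]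
  simp only [itinerary, Int.toNat_natCast, this]

open Classical in
/-- If the itinerary on a block is governed by the levels `i ≥ m`, apart from a margin of length `d`
at the beginning of the block, then this prevails over the lower levels. -/
theorem card_itinerary_ge (h : LargeDigits α a) {τ : Side} {X L d : ℤ} {m : ℕ} (hd : 0 ≤ d)
    (hL : cfDen a m ≤ L)
    (hmain : ∀ K, X + d ≤ K → K < X + L → (∀ i < m, levelCount α a J i K = 0) →
      itinerary α a J K = τ) :
    (L : ℝ) - d - 4 * L * ∑ i ∈ Finset.range m, 1 / (a i : ℝ)
      ≤ (((Finset.Ico X (X + L)).filter fun K => itinerary α a J K = τ).card : ℝ) := by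
  set G := (Finset.Ico X (X + L)).filter fun K => itinerary α a J K = τ
  set B := (Finset.Ico X (X + L)).filter fun K => ∃ i < m, levelCount α a J i K ≠ 0
  have hsub : Finset.Ico (X + d) (X + L) ⊆ G ∪ B := by
    intro K hK
    rw [Finset.mem_Ico] at hK
    by_cases hB : ∃ i < m, levelCount α a J i K ≠ 0
    · exact Finset.mem_union_right _
        (Finset.mem_filter.2 ⟨Finset.mem_Ico.2 ⟨by omega, hK.2⟩, hB⟩)
    · push Not at hB
      exact Finset.mem_union_left _
        (Finset.mem_filter.2 ⟨Finset.mem_Ico.2 ⟨by omega, hK.2⟩, hmain K hK.1 hK.2 hB⟩)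
  have h1 := (Finset.card_le_card hsub).trans (Finset.card_union_le _ _)
  rw [Int.card_Ico] at h1
  have h2 : (L : ℝ) - d ≤ G.card + B.card := by
    have : L - d ≤ (G.card : ℤ) + B.card := by omega
    exact_mod_cast this
  have h3 : (B.card : ℝ) ≤ 4 * L * ∑ i ∈ Finset.range m, 1 / (a i : ℝ) := by
    calc (B.card : ℝ) ≤ ∑ K ∈ Finset.Ico X (X + L), ∑ i ∈ Finset.range m,
          (levelCount α a J i K : ℝ) := by
          rw [← Finset.sum_boole]
          refine Finset.sum_le_sum fun K _ => ?_
          have h0 : 0 ≤ ∑ i ∈ Finset.range m, (levelCount α a J i K : ℝ) :=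
            Finset.sum_nonneg fun _ _ => Nat.cast_nonneg _
          split_ifs with hK
          · obtain ⟨i, hi, hne⟩ := hK
            have h5 := Finset.single_le_sum (f := fun i => (levelCount α a J i K : ℝ))
              (fun _ _ => Nat.cast_nonneg _) (Finset.mem_range.2 hi)
            have h6 : (1 : ℝ) ≤ levelCount α a J i K := by
              exact_mod_cast Nat.one_le_iff_ne_zero.2 hne
            exact h6.trans h5
          · exact h0
      _ = ∑ i ∈ Finset.range m, ∑ K ∈ Finset.Ico X (X + L), (levelCount α a J i K : ℝ) :=
          Finset.sum_comm
      _ ≤ ∑ i ∈ Finset.range m, 4 * L * (1 / (a i : ℝ)) := by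
          refine Finset.sum_le_sum fun i hi => h.sum_levelCount_le i X ?_
          exact (h.den_mono (Finset.mem_range.1 hi)).trans hL
      _ = _ := by rw [Finset.mul_sum]
  linarith

/-- The window of length `q_m` at level `m` meets the return `0` for `2 q_m ≤ K < 3 q_m`. -/
theorem resonant_of_even (h : LargeDigits α a) {m : ℕ} (hm0 : 0 < m) (hm : Even m) :
    Resonant α a J m 2 := by
  intro K h0 h1 h2 h3 h4 hlow
  obtain ⟨l, rfl⟩ : ∃ l, m = l + 1 := ⟨m - 1, by omega⟩
  rw [Nat.add_sub_cancel] at h0 h2 h3 h4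
  obtain ⟨-, -, u2, u3⟩ := h.digitDen_bounds (one_le_lowDigit (J := J)) lowDigit_le l
  obtain ⟨-, -, v2, v3⟩ := h.digitDen_bounds (one_le_highDigit (J := J)) highDigit_le l
  have hq := h.den_pos l
  have hq1 := h.mul_den_le l
  have hq2 := h.mul_den_le (l + 1)
  rw [h.itinerary_eq hm.add_one (by omega) h1, Finset.sum_range_succ,
    Finset.sum_eq_zero fun i hi => hlow i (Finset.mem_range.1 hi), zero_add]
  simp only [levelCount, if_pos hm]
  have hmr : mainReturn a (l + 1) = 0 := if_pos hm
  generalize digitDen a (lowDigit J) (l + 1) = u at *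
  generalize digitDen a (highDigit J) (l + 1) = u' at *
  rw [h.returnCount_eq, h.returnCount_eq, h.returnCount_eq]
  all_goals rw [hmr]
  all_goals generalize cfDen a (l + 1 + 1) = q2 at *
  all_goals generalize cfDen a (l + 1) = q1 at *
  all_goals generalize cfDen a l = q0 at *
  any_goals omega
  exact side_of_parity_three _ _ _ _ (by omega) (by omega) (by omega)

/-- The window of length `q_m` at level `m` meets the return `q_m` for `2 q_m ≤ K < 3 q_m`, and the
window between the two endpoints at level `m + 1` meets the return `0` for `q_m ≤ K < 3 q_m`. -/
theorem resonant_of_odd (h : LargeDigits α a) {m : ℕ} (hm : Odd m) (hJ : J m) :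
    Resonant α a J m 1 := by
  intro K h0 h1 h2 h3 h4 hlow
  obtain ⟨l, rfl⟩ : ∃ l, m = l + 1 := ⟨m - 1, by have := hm.pos; omega⟩
  rw [Nat.add_sub_cancel] at h0 h2 h3 h4
  obtain ⟨-, -, u2, u3⟩ := h.digitDen_bounds (one_le_lowDigit (J := J)) lowDigit_le l
  obtain ⟨-, -, v2, v3⟩ := h.digitDen_bounds (one_le_highDigit (J := J)) highDigit_le l
  have hq := h.den_pos l
  have hq1 := h.mul_den_le l
  have hq2 := h.mul_den_le (l + 1)
  have hq3 := h.mul_den_le (l + 1 + 1)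
  have hne : ¬Even (l + 1) := Nat.not_even_iff_odd.2 hm
  have he : Even (l + 1 + 1) := hm.add_one
  rw [h.itinerary_eq he.add_one (by omega) (by omega), Finset.sum_range_succ,
    Finset.sum_range_succ, Finset.sum_eq_zero fun i hi => hlow i (Finset.mem_range.1 hi), zero_add]
  simp only [levelCount, if_pos he, if_neg hne, if_pos hJ]
  -- the offsets of level `m + 1` in terms of those of level `m`
  rw [digitDen_succ _ _ (l + 1), digitDen_succ _ _ (l + 1)]
  simp only [lowDigit, highDigit, if_neg hne, if_pos hJ]
  change (if Even (_ + (returnCount α a (l + 1 + 1) _ _ + _ + _)) then _ else _) = _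
  have hmr : mainReturn a (l + 1) = cfDen a (l + 1) := if_neg hne
  have hmr' : mainReturn a (l + 1 + 1) = 0 := if_pos he
  generalize digitDen a _ (l + 1) = u at *
  generalize digitDen a _ (l + 1) = u' at *
  rw [h.returnCount_eq, h.returnCount_eq, h.returnCount_eq, h.returnCount_eq, h.returnCount_eq]
  all_goals simp only [hmr, hmr']
  all_goals generalize cfDen a (l + 1 + 1 + 1) = q3 at *
  all_goals generalize cfDen a (l + 1 + 1) = q2 at *
  all_goals generalize cfDen a (l + 1) = q1 at *
  all_goals generalize cfDen a l = q0 at *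
  any_goals omega
  exact side_of_parity_five _ _ _ _ _ _ (by omega) (by omega) (by omega) (by omega)

variable {s : ℝ}

open Classical in
/-- Of the proportion `14 s` of exceptional times, `10 s` accounts for the margin and `4 s` for the
lower levels. -/
theorem card_block_ge (h : LargeDigits α a) {m : ℕ} (hm : 0 < m) {r b : ℤ}
    (hres : Resonant α a J m r) (hr : 0 ≤ r) (hb0 : 0 ≤ b) (hb : b + 1 ≤ a m)
    (hs : ∀ n, ∑ i ∈ Finset.range n, 1 / (a i : ℝ) ≤ s) :
    (cfDen a m : ℝ) * (1 - 14 * s) ≤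
      (((Finset.Ico (b * cfDen a m) (b * cfDen a m + cfDen a m)).filter fun K =>
        itinerary α a J K = if b = r then Side.right else Side.left).card : ℝ) := by
  have hq := h.den_pos m
  have hq0 := h.den_pos (m - 1)
  have hq1 := h.digit_mul_den_le m
  have hbq : 0 ≤ b * cfDen a m := mul_nonneg hb0 hq.le
  have hbq' : b * cfDen a m + cfDen a m ≤ cfDen a (m + 1) := by nlinarith
  have h1 := h.card_itinerary_ge (J := J) (X := b * cfDen a m) (L := cfDen a m)
    (d := 10 * cfDen a (m - 1)) (m := m) (τ := if b = r then Side.right else Side.left)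
    (by omega) le_rfl ?_
  · have h2 := h.den_le_div (m - 1) (L := cfDen a m)
      (by rw [Nat.sub_add_cancel hm])
    have h3 := one_div_digit_le hs (m - 1)
    have h4 := hs m
    have hqR : (0 : ℝ) < cfDen a m := by exact_mod_cast hq
    push_cast at h1
    refine le_trans ?_ h1
    nlinarith
  · intro K hK1 hK2 hlow
    have hout : ∀ c : ℤ, 0 ≤ c → K < c * cfDen a m ∨
        c * cfDen a m + 10 * cfDen a (m - 1) ≤ K := by
      intro c _
      rcases le_or_gt c b with hc | hc
      · right; nlinarith
      · left
        have : b + 1 ≤ c := hc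
        nlinarith
    have e1 := hout 1 (by norm_num)
    rw [one_mul] at e1
    rw [hres K (by omega) (by omega) e1 (hout 2 (by norm_num)) (hout 3 (by norm_num)) hlow]
    by_cases hbr : b = r
    · subst hbr
      rw [if_pos rfl, if_pos ⟨by omega, by linarith⟩]
    · rw [if_neg hbr, if_neg]
      rintro ⟨g1, g2⟩
      rcases lt_or_gt_of_ne hbr with hlt | hlt
      · have : b + 1 ≤ r := hlt
        nlinarith
      · have : r + 1 ≤ b := hlt
        nlinarith

/-- In a time block of length `T`, `T` being proportional to `q_m`, the geodesic prefers the square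
that resonance assigns to the block. -/
theorem block_visitTime_ge (h : LargeDigits α a) {g c : ℝ} (hc : 0 < c)
    {L : ℝ → TwoSquareSurface g}
    (hL : ∀ t, L t ∈ constituentSquare g (itinerary α a J ⌊t / c⌋)) {m : ℕ} (hm : 0 < m) {r : ℤ}
    {b : ℕ} (hres : Resonant α a J m r) (hr : 0 ≤ r) (hb : (b : ℝ) + 1 ≤ a m)
    (hs : ∀ n, ∑ i ∈ Finset.range n, 1 / (a i : ℝ) ≤ s) {T u v : ℝ} (hT : T = c * cfDen a m)
    (hu : u = b * T) (hv : v = (b + 1) * T) :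
    1 - 14 * s ≤ 1 / T * visitTime L (if (b : ℤ) = r then Side.right else Side.left) u v := by
  classical
  subst hT hu hv
  have hqR : (0 : ℝ) < cfDen a m := by exact_mod_cast h.den_pos m
  have h1 := h.card_block_ge hm hres hr (b := b) (by positivity) (by exact_mod_cast hb) hs
  have h2 := card_mul_le_visitTime hc hL (if (b : ℤ) = r then Side.right else Side.left)
    (u := b * (c * cfDen a m)) (v := (b + 1) * (c * cfDen a m))
    (S := (Finset.Ico ((b : ℤ) * cfDen a m) (b * cfDen a m + cfDen a m)).filter fun K =>
        itinerary α a J K = if (b : ℤ) = r then Side.right else Side.left) ?_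
  · rw [one_div, inv_mul_eq_div, le_div_iff₀ (by positivity)]
    refine le_trans ?_ h2
    have := mul_le_mul_of_nonneg_left h1 hc.le
    linarith
  · intro K hK
    rw [Finset.mem_filter, Finset.mem_Ico] at hK
    obtain ⟨⟨h3, h4⟩, h5⟩ := hK
    refine ⟨h5, ?_, ?_⟩
    · have : ((b * cfDen a m : ℤ) : ℝ) ≤ K := by exact_mod_cast h3
      push_cast at this
      have := mul_le_mul_of_nonneg_left this hc.le
      linarith
    · have : ((K + 1 : ℤ) : ℝ) ≤ ((b * cfDen a m + cfDen a m : ℤ) : ℝ) := by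
        exact_mod_cast (by omega : K + 1 ≤ b * cfDen a m + cfDen a m)
      push_cast at this
      have := mul_le_mul_of_nonneg_left this hc.le
      linarith

/-! ### The right square on an initial segment -/

/-- An even level keeps the geodesic in the right square for at most a third of the time, up to
the short windows and the later returns. -/
theorem sum_levelCount_even_le (h : LargeDigits α a) {N : ℕ} (hN0 : 0 < N) (hN : Even N) {L : ℤ}
    (hL : cfDen a N ≤ L) :
    ∑ K ∈ Finset.Ico 0 L, (levelCount α a J N K : ℝ)
      ≤ L / 3 + L * (1 / a N) + 20 * L * (1 / a (N - 1)) := by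
  obtain ⟨l, rfl⟩ : ∃ l, N = l + 1 := ⟨N - 1, by omega⟩
  rw [Nat.add_sub_cancel]
  have hd := (h.abs_offset_sub_le (J := J) l).2
  obtain ⟨-, -, v2, v3⟩ := h.digitDen_bounds (one_le_highDigit (J := J)) highDigit_le l
  have hq0 := h.den_pos l
  have hq1 := h.mul_den_le l
  have hq2 := h.mul_den_le (l + 1)
  have hL0 : 0 ≤ L := by omega
  have b1 := h.den_le_div l (L := cfDen a (l + 1)) le_rfl
  have b2 := h.den_le_div l (L := L) (by exact_mod_cast hL)
  have b3 := h.den_le_div (l + 1) (L := cfDen a (l + 1 + 1)) le_rfl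
  simp only [levelCount, if_pos hN]
  push_cast
  set u := digitDen a (lowDigit J) (l + 1)
  set u' := digitDen a (highDigit J) (l + 1)
  set q := cfDen a (l + 1)
  set Q := cfDen a (l + 1 + 1) with hQ
  have hqR : (0 : ℝ) < q := by exact_mod_cast (by omega : 0 < q)
  have hQR : (0 : ℝ) < Q := by exact_mod_cast (by omega : 0 < Q)
  have hqQR : (q : ℝ) ≤ Q := by exact_mod_cast (by omega : q ≤ Q)
  have hLR : (0 : ℝ) ≤ L := by exact_mod_cast hL0
  have s1 := h.sum_returnCount_le (l + 1) u u' 0 hL0 hd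
  have s2 := h.sum_returnCount_le (l + 1) (u + q) (u' + q) 0 hL0 (l := 5 * cfDen a l)
    (by rw [add_sub_add_right_eq_sub]; exact hd)
  rw [zero_add, ← hQ] at s1 s2
  have c1 : (cfDen a l : ℝ) * (L / Q) ≤ L * (1 / a l) := by
    rw [mul_div_assoc', div_le_iff₀ hQR]
    have : 0 ≤ L * (1 / (a l : ℝ)) := by positivity
    have := one_div_digit_nonneg a l
    nlinarith
  have c2 : (q : ℝ) * (L / Q) ≤ L * (1 / a (l + 1)) := by
    rw [mul_div_assoc', div_le_iff₀ hQR]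
    nlinarith
  have s3 : ∑ K ∈ Finset.Ico 0 L, (returnCount α a (l + 1) (K - u' - 3 * q) (K - u' - 2 * q) : ℝ)
      ≤ L / 3 + L * (1 / a (l + 1)) := by
    rcases le_or_gt (3 * q) L with hcase | hcase
    · have s := h.sum_returnCount_le (l + 1) (u' + 3 * q) (u' + 2 * q) 0 hL0 (l := q)
        (by rw [abs_le]; constructor <;> omega)
      rw [zero_add, ← hQ] at s
      simp only [← sub_sub] at s
      have : (3 * q : ℝ) ≤ L := by exact_mod_cast hcase
      linarith
    · -- before the time `3 q`, the window is visited only after the time `2 q`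
      have hmr : mainReturn a (l + 1) = 0 := if_pos hN
      have hpt : ∀ K ∈ Finset.Ico 0 L,
          (returnCount α a (l + 1) (K - u' - 3 * q) (K - u' - 2 * q) : ℝ)
            ≤ if 2 * q ≤ K then 1 else 0 := by
        intro K hK
        rw [Finset.mem_Ico] at hK
        rw [h.returnCount_eq (by omega) (by omega) (by omega) (by omega), hmr]
        split_ifs <;> first | omega | norm_num
      refine (Finset.sum_le_sum hpt).trans ?_
      rw [Finset.sum_boole]
      have hcard : ((Finset.Ico 0 L).filter fun K => 2 * q ≤ K).card
          ≤ (Finset.Ico (2 * q) L).card := by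
        refine Finset.card_le_card fun K hK => ?_
        rw [Finset.mem_filter, Finset.mem_Ico] at hK
        exact Finset.mem_Ico.2 ⟨hK.2, hK.1.2⟩
      rw [Int.card_Ico] at hcard
      have h3 : (3 * ((Finset.Ico 0 L).filter fun K => 2 * q ≤ K).card : ℝ) ≤ L := by
        have : 3 * (((Finset.Ico 0 L).filter fun K => 2 * q ≤ K).card : ℤ) ≤ L := by omega
        exact_mod_cast this
      have : 0 ≤ L * (1 / (a (l + 1) : ℝ)) := by positivity
      linarith
  simp only [← sub_sub] at s1 s2
  rw [Finset.sum_add_distrib, Finset.sum_add_distrib]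
  push_cast at s1 s2
  linarith

/-- An odd level that is not active has only short windows, and they are not met before the time
`q_{N+1}`. -/
theorem sum_levelCount_odd_le (h : LargeDigits α a) {N : ℕ} (hN : Even N) (hJ : ¬J (N + 1))
    {L : ℤ} (hL0 : 0 ≤ L) (hL : L < cfDen a (N + 2)) :
    ∑ K ∈ Finset.Ico 0 L, (levelCount α a J (N + 1) K : ℝ) ≤ 20 * L * (1 / a N) := by
  have hne : ¬Even (N + 1) := by rw [Nat.not_even_iff_odd]; exact hN.add_one
  have hd := (h.abs_offset_sub_le (J := J) N).2
  obtain ⟨-, -, u2, u3⟩ := h.digitDen_bounds (one_le_lowDigit (J := J)) lowDigit_le N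
  obtain ⟨-, -, v2, v3⟩ := h.digitDen_bounds (one_le_highDigit (J := J)) highDigit_le N
  have hq0 := h.den_pos N
  have hq1 := h.mul_den_le N
  have hq2 := h.mul_den_le (N + 1)
  have hLR : (0 : ℝ) ≤ L := by exact_mod_cast hL0
  simp only [levelCount, if_neg hne, if_neg hJ]
  push_cast
  rcases le_or_gt L (cfDen a (N + 1)) with hcase | hcase
  · have hmr : mainReturn a (N + 1) = cfDen a (N + 1) := if_neg hne
    refine le_trans (le_of_eq (Finset.sum_eq_zero fun K hK => ?_)) (by positivity)
    rw [Finset.mem_Ico] at hK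
    rw [h.returnCount_eq (by omega) (by omega) (by omega) (by omega), hmr,
      h.returnCount_eq (by omega) (by omega) (by omega) (by omega), hmr, if_neg (by omega),
      if_neg (by omega)]
    simp
  · have b1 := h.den_le_div N (L := L) (by exact_mod_cast hcase.le)
    set u := digitDen a (lowDigit J) (N + 1)
    set u' := digitDen a (highDigit J) (N + 1)
    set q := cfDen a (N + 1)
    set Q := cfDen a (N + 1 + 1) with hQ
    have s1 := h.sum_returnCount_le (N + 1) u u' 0 hL0 hd
    have s2 := h.sum_returnCount_le (N + 1) (u + q) (u' + q) 0 hL0 (l := 5 * cfDen a N)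
      (by rw [add_sub_add_right_eq_sub]; exact hd)
    rw [zero_add, ← hQ] at s1 s2
    have hQR : (0 : ℝ) < Q := by exact_mod_cast (by omega : 0 < Q)
    have hLQ : (L : ℝ) / Q ≤ 1 := by
      rw [div_le_one hQR]; exact_mod_cast hL.le
    have hq0R : (0 : ℝ) < cfDen a N := by exact_mod_cast hq0
    simp only [← sub_sub] at s1 s2
    rw [Finset.sum_add_distrib]
    push_cast at s1 s2
    nlinarith

/-- Before the time `q_{N+2}`, level `N + 2` only has the window between the two endpoints. This is
short, because the digits of the inactive level `N + 1` are equal, and it is not met before the time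
`q_{N+1}`. -/
theorem sum_levelCount_next_even_le (h : LargeDigits α a) {N : ℕ} (hN : Even N) (hJ : ¬J (N + 1))
    {L : ℤ} (hL0 : 0 ≤ L) (hL : L < cfDen a (N + 2)) :
    ∑ K ∈ Finset.Ico 0 L, (levelCount α a J (N + 2) K : ℝ) ≤ 10 * L * (1 / a N) := by
  have hne : ¬Even (N + 1) := by rw [Nat.not_even_iff_odd]; exact hN.add_one
  have he : Even (N + 2) := hN.add even_two
  have hmr : mainReturn a (N + 2) = 0 := if_pos he
  have hd : |digitDen a (highDigit J) (N + 2) - digitDen a (lowDigit J) (N + 2)|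
      ≤ 5 * cfDen a N := by
    rw [digitDen_succ _ _ (N + 1), digitDen_succ _ _ (N + 1)]
    have hlow : lowDigit J (N + 1) = 2 := by simp only [lowDigit, if_neg hne, if_neg hJ]
    have hhigh : highDigit J (N + 1) = 2 := by simp only [highDigit, if_neg hne, if_neg hJ]
    rw [hlow, hhigh, add_sub_add_right_eq_sub]
    exact (h.abs_offset_sub_le (J := J) N).2
  obtain ⟨-, -, u2, u3⟩ := h.digitDen_bounds (one_le_lowDigit (J := J)) lowDigit_le (N + 1)
  obtain ⟨-, -, v2, v3⟩ := h.digitDen_bounds (one_le_highDigit (J := J)) highDigit_le (N + 1)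
  have hq0 := h.den_pos N
  have hq1 := h.mul_den_le N
  have hq2 := h.mul_den_le (N + 1)
  have hq3 := h.mul_den_le (N + 2)
  have hLR : (0 : ℝ) ≤ L := by exact_mod_cast hL0
  simp only [levelCount, if_pos he]
  push_cast
  change digitDen a (lowDigit J) (N + 2) ≤ _ at u3
  change digitDen a (highDigit J) (N + 2) ≤ _ at v3
  change _ ≤ digitDen a (lowDigit J) (N + 2) at u2
  change _ ≤ digitDen a (highDigit J) (N + 2) at v2
  change 300 * cfDen a (N + 1) ≤ cfDen a (N + 2) at hq2
  change 300 * cfDen a (N + 2) ≤ cfDen a (N + 2 + 1) at hq3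
  set u := digitDen a (lowDigit J) (N + 2)
  set u' := digitDen a (highDigit J) (N + 2)
  set q := cfDen a (N + 2)
  set Q := cfDen a (N + 2 + 1) with hQ
  have hpt : ∀ K ∈ Finset.Ico 0 L,
      (returnCount α a (N + 2) (K - u' - 3 * q) (K - u' - 2 * q) : ℝ)
        + returnCount α a (N + 2) (K - u) (K - u')
        + returnCount α a (N + 2) (K - u - q) (K - u' - q)
      = returnCount α a (N + 2) (K - u) (K - u') := by
    intro K hK
    rw [Finset.mem_Ico] at hK
    rw [h.returnCount_eq (x := K - u' - 3 * q) (by omega) (by omega) (by omega) (by omega), hmr,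
      h.returnCount_eq (x := K - u - q) (by omega) (by omega) (by omega) (by omega), hmr,
      if_neg (by omega), if_neg (by omega)]
    simp
  rw [Finset.sum_congr rfl hpt]
  rcases le_or_gt L (cfDen a (N + 1)) with hcase | hcase
  · refine le_trans (le_of_eq (Finset.sum_eq_zero fun K hK => ?_)) (by positivity)
    rw [Finset.mem_Ico] at hK
    rw [h.returnCount_eq (by omega) (by omega) (by omega) (by omega), hmr, if_neg (by omega)]
    simp
  · have b1 := h.den_le_div N (L := L) (by exact_mod_cast hcase.le)
    have s1 := h.sum_returnCount_le (N + 2) u u' 0 hL0 hd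
    rw [zero_add, ← hQ] at s1
    have hQR : (0 : ℝ) < Q := by exact_mod_cast (by omega : 0 < Q)
    have hLQ : (L : ℝ) / Q ≤ 1 := by
      rw [div_le_one hQR]; exact_mod_cast (by omega : L ≤ Q)
    have hq0R : (0 : ℝ) < cfDen a N := by exact_mod_cast hq0
    push_cast at s1
    nlinarith

open Classical in
/-- If the odd levels are not active, an initial segment of the itinerary is in the right square for
at most about one third of the time. -/
theorem card_right_le (h : LargeDigits α a) {N : ℕ} (hN0 : 0 < N) (hN : Even N) (hJ : ¬J (N + 1))
    {L : ℤ} (hL1 : cfDen a N ≤ L) (hL2 : L < cfDen a (N + 2))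
    (hs : ∀ n, ∑ i ∈ Finset.range n, 1 / (a i : ℝ) ≤ s) :
    (((Finset.Ico 0 L).filter fun K => itinerary α a J K = Side.right).card : ℝ)
      ≤ (1 / 3 + 55 * s) * L := by
  have hL0 : 0 ≤ L := (h.den_pos N).le.trans hL1
  have hLR : (0 : ℝ) ≤ L := by exact_mod_cast hL0
  have hodd : Odd (N + 3) := (hN.add even_two).add_one
  have hpt : ∀ K ∈ Finset.Ico 0 L, (if itinerary α a J K = Side.right then (1 : ℝ) else 0)
      ≤ ∑ i ∈ Finset.range (N + 3), (levelCount α a J i K : ℝ) := by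
    intro K hK
    rw [Finset.mem_Ico] at hK
    rw [h.itinerary_eq hodd hK.1 ((hK.2.trans hL2).trans_le (h.den_mono (by omega))),
      ← Nat.cast_sum]
    by_cases he : Even (∑ i ∈ Finset.range (N + 3), levelCount α a J i K)
    · simp only [if_pos he, reduceCtorEq, if_false]; positivity
    · simp only [if_neg he, if_true]
      have : 0 < ∑ i ∈ Finset.range (N + 3), levelCount α a J i K :=
        (Nat.not_even_iff_odd.1 he).pos
      exact_mod_cast this
  rw [← Finset.sum_boole]
  refine (Finset.sum_le_sum hpt).trans ?_
  rw [Finset.sum_comm, Finset.sum_range_succ, Finset.sum_range_succ, Finset.sum_range_succ]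
  have h1 : ∑ i ∈ Finset.range N, ∑ K ∈ Finset.Ico 0 L, (levelCount α a J i K : ℝ)
      ≤ ∑ i ∈ Finset.range N, 4 * L * (1 / (a i : ℝ)) := by
    refine Finset.sum_le_sum fun i hi => ?_
    have := h.sum_levelCount_le (J := J) i 0
      ((h.den_mono (Nat.succ_le_of_lt (Finset.mem_range.1 hi))).trans hL1)
    rwa [zero_add] at this
  rw [← Finset.mul_sum] at h1
  have h2 := h.sum_levelCount_even_le (J := J) hN0 hN hL1
  have h3 := h.sum_levelCount_odd_le hN hJ hL0 hL2
  have h4 := h.sum_levelCount_next_even_le hN hJ hL0 hL2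
  have e1 := mul_le_mul_of_nonneg_left (hs N) hLR
  have e2 := mul_le_mul_of_nonneg_left (one_div_digit_le hs N) hLR
  have e3 := mul_le_mul_of_nonneg_left (one_div_digit_le hs (N - 1)) hLR
  linarith

theorem exists_even_scale (h : LargeDigits α a) {j : ℕ} {L : ℤ} (hL : cfDen a (2 * j) ≤ L) :
    ∃ k, j ≤ k ∧ cfDen a (2 * k) ≤ L ∧ L < cfDen a (2 * k + 2) := by
  have hex : ∃ k, L < cfDen a (2 * k + 2) := by
    refine ⟨L.toNat, ?_⟩
    have := h.nat_lt_den (2 * L.toNat + 2)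
    omega
  classical
  by_cases h0 : L < cfDen a (2 * j + 2)
  · exact ⟨j, le_rfl, hL, h0⟩
  · have hk := Nat.find_spec hex
    have hlt : j < Nat.find hex := by
      by_contra hle
      push Not at hle
      exact h0 (hk.trans_le (h.den_mono (by omega)))
    refine ⟨Nat.find hex, hlt.le, ?_, hk⟩
    have := Nat.find_min hex (m := Nat.find hex - 1) (by omega)
    rw [show 2 * (Nat.find hex - 1) + 2 = 2 * Nat.find hex by omega] at this
    exact not_lt.1 this

/-- If the odd levels are not active from some point on, then in the long run the geodesic spends
about two thirds of the time in the left square, or more. -/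
theorem exists_visitTime_left_gt (h : LargeDigits α a) {g c ε : ℝ} (hc : 0 < c) (hε0 : 0 < ε)
    (hε1 : ε < 1) {L : ℝ → TwoSquareSurface g}
    (hL : ∀ t, L t ∈ constituentSquare g (itinerary α a J ⌊t / c⌋)) {n : ℕ}
    (hJ : ∀ i, n ≤ i → ¬J i) (hs : ∀ n, ∑ i ∈ Finset.range n, 1 / (a i : ℝ) ≤ s)
    (hsε : s < ε / 300) :
    ∃ W₀ : ℝ, 0 < W₀ ∧ ∀ W, W₀ < W → 2 / 3 - ε < 1 / W * visitTime L Side.left 0 W := by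
  classical
  have hq : (0 : ℝ) < cfDen a (2 * (n + 1)) := by exact_mod_cast h.den_pos _
  refine ⟨c * (cfDen a (2 * (n + 1)) + 1 / ε + 1), by positivity, fun W hW => ?_⟩
  have hWpos : 0 < W := lt_trans (by positivity) hW
  set M := ⌊W / c⌋ with hM
  have hM1 : (M : ℝ) ≤ W / c := Int.floor_le _
  have hM2 : W / c < M + 1 := Int.lt_floor_add_one _
  have hW' : cfDen a (2 * (n + 1)) + 1 / ε + 1 < W / c := by
    rw [lt_div_iff₀ hc]; linarith
  have hMq : (cfDen a (2 * (n + 1)) : ℝ) ≤ M := by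
    have : 0 < 1 / ε := by positivity
    linarith
  have hMε : 1 / ε < M := by linarith
  rw [div_lt_iff₀ hε0] at hMε
  rw [le_div_iff₀ hc] at hM1
  rw [div_lt_iff₀ hc] at hM2
  obtain ⟨k, hk1, hk2, hk3⟩ := h.exists_even_scale (j := n + 1) (L := M) (by exact_mod_cast hMq)
  have hright := h.card_right_le (J := J) (N := 2 * k) (by omega) (by simp) (hJ _ (by omega))
    hk2 hk3 hs
  have hMpos : (0 : ℝ) < M := by linarith
  have hM0 : 0 ≤ M := by
    have : (0 : ℝ) ≤ M := hMpos.le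
    exact_mod_cast this
  have hsum := Finset.card_filter_add_card_filter_not (s := Finset.Ico 0 M)
    (fun K => itinerary α a J K = Side.right)
  rw [Int.card_Ico] at hsum
  have hleft : ((Finset.Ico 0 M).filter fun K => itinerary α a J K = Side.left)
      = (Finset.Ico 0 M).filter fun K => ¬itinerary α a J K = Side.right := by
    refine Finset.filter_congr fun K _ => ?_
    cases itinerary α a J K <;> simp
  rw [← hleft] at hsum
  have hsumR : ((((Finset.Ico 0 M).filter fun K => itinerary α a J K = Side.right).card : ℝ))
      + ((Finset.Ico 0 M).filter fun K => itinerary α a J K = Side.left).card = M := by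
    have : ((((Finset.Ico 0 M).filter fun K => itinerary α a J K = Side.right).card : ℤ))
      + ((Finset.Ico 0 M).filter fun K => itinerary α a J K = Side.left).card = M := by omega
    exact_mod_cast this
  have hvis := card_mul_le_visitTime hc hL Side.left (u := 0) (v := W)
    (S := (Finset.Ico 0 M).filter fun K => itinerary α a J K = Side.left) ?_
  · rw [one_div, inv_mul_eq_div, lt_div_iff₀ hWpos]
    refine lt_of_lt_of_le ?_ hvis
    have h1 : (2 / 3 - 55 * s) * M
        ≤ ((Finset.Ico 0 M).filter fun K => itinerary α a J K = Side.left).card := by linarith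
    have h2 : (2 / 3 - ε) * W < c * ((2 / 3 - 55 * s) * M) := by
      have h3 : (2 / 3 - ε / 5) * M ≤ (2 / 3 - 55 * s) * M :=
        mul_le_mul_of_nonneg_right (by linarith) hMpos.le
      have h4 := mul_le_mul_of_nonneg_left h3 hc.le
      refine lt_of_lt_of_le ?_ h4
      rcases le_or_gt (2 / 3 - ε) 0 with h5 | h5
      · have h6 : (2 / 3 - ε) * W ≤ 0 := mul_nonpos_of_nonpos_of_nonneg h5 hWpos.le
        have h7 : 0 < c * ((2 / 3 - ε / 5) * M) := by
          have : 0 < 2 / 3 - ε / 5 := by linarith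
          positivity
        linarith
      · have h6 := mul_lt_mul_of_pos_left hM2 h5
        have h7 : (2 / 3 - ε) * (M + 1) < (2 / 3 - ε / 5) * M := by nlinarith
        have h8 := mul_lt_mul_of_pos_left h7 hc
        linarith
    exact h2.trans_le (mul_le_mul_of_nonneg_left h1 hc.le)
  · intro K hK
    rw [Finset.mem_filter, Finset.mem_Ico] at hK
    obtain ⟨⟨h3, h4⟩, h5⟩ := hK
    refine ⟨h5, ?_, ?_⟩
    · have : (0 : ℝ) ≤ K := by exact_mod_cast h3
      positivity
    · have : ((K + 1 : ℤ) : ℝ) ≤ M := by exact_mod_cast (by omega : K + 1 ≤ M)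
      push_cast at this
      have := mul_le_mul_of_nonneg_left this hc.le
      linarith

end LargeDigits

/-! ### Gates and starting points as digit expansions -/

section Gates

variable {α : ℝ} {a : ℕ → ℕ} {J : ℕ → Prop} [DecidablePred J]

theorem LargeDigits.digitPoint_bounds (h : LargeDigits α a) (J : ℕ → Prop) [DecidablePred J] :
    0 < digitPoint α a (lowDigit J) ∧ digitPoint α a (lowDigit J) < 3 * α ∧
    3 * α < digitPoint α a (highDigit J) ∧ digitPoint α a (highDigit J) < 5 * α := by
  have h1 := abs_le.1 (h.abs_tsum_sub_sum_le
    (fun i => abs_le.2 ⟨by linarith [one_le_lowDigit (J := J) i], lowDigit_le (J := J) i⟩) 1)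
  have h2 := abs_le.1 (h.abs_tsum_sub_sum_le
    (fun i => abs_le.2 ⟨by linarith [one_le_highDigit (J := J) i], highDigit_le (J := J) i⟩) 1)
  have h3 := h.mul_abs_eta_le 0
  have h4 := h.alpha_pos
  rw [cfEta_zero, abs_of_pos h4] at h3
  simp only [Finset.sum_range_one, cfEta_zero] at h1 h2
  have h5 : lowDigit J 0 = 2 := by simp [lowDigit]
  have h6 : highDigit J 0 = 4 := by simp [highDigit]
  rw [h5] at h1
  rw [h6] at h2
  push_cast at h1 h2
  unfold digitPoint
  refine ⟨?_, ?_, ?_, ?_⟩ <;> linarith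

theorem etaSum_eq_digitPoint (heta : ∀ i, eta α i = cfEta α a i) (c : ℕ → ℤ) :
    etaSum α c = digitPoint α a c := by
  simp only [etaSum, digitPoint, heta]

theorem etaSum_sub (h : LargeDigits α a) (heta : ∀ i, eta α i = cfEta α a i) {c : ℕ → ℤ}
    (hc : ∀ i, c i = highDigit J i - lowDigit J i) :
    etaSum α c = digitPoint α a (highDigit J) - digitPoint α a (lowDigit J) := by
  rw [etaSum_eq_digitPoint heta, digitPoint, digitPoint, digitPoint, ← Summable.tsum_sub]
  · refine tsum_congr fun i => ?_
    rw [hc]; push_cast; ring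
  · exact h.summable_mul_eta fun i =>
      abs_le.2 ⟨by linarith [one_le_highDigit (J := J) i], highDigit_le i⟩
  · exact h.summable_mul_eta fun i =>
      abs_le.2 ⟨by linarith [one_le_lowDigit (J := J) i], lowDigit_le i⟩

theorem gateZero_eq (h : LargeDigits α a) (heta : ∀ i, eta α i = cfEta α a i) :
    gateZero α = digitPoint α a (highDigit fun _ => True)
      - digitPoint α a (lowDigit fun _ => True) :=
  etaSum_sub h heta fun i => by simp only [highDigit, lowDigit]; split_ifs <;> norm_num

theorem startZero_eq (heta : ∀ i, eta α i = cfEta α a i) :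
    startZero α = 1 - digitPoint α a (lowDigit fun _ => True) := by
  rw [startZero, etaSum_eq_digitPoint heta]
  congr 2

theorem gateOne_eq (h : LargeDigits α a) (heta : ∀ i, eta α i = cfEta α a i) (n : ℕ) :
    gateOne α n = digitPoint α a (highDigit (· < 2 * n + 2))
      - digitPoint α a (lowDigit (· < 2 * n + 2)) :=
  etaSum_sub h heta fun i => by simp only [highDigit, lowDigit]; split_ifs <;> norm_num

theorem startOne_eq (heta : ∀ i, eta α i = cfEta α a i) (n : ℕ) :
    startOne α n = 1 - digitPoint α a (lowDigit (· < 2 * n + 2)) := by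
  rw [startOne, etaSum_eq_digitPoint heta]
  rfl

/-- The itinerary of the orbit is realized by a geodesic. -/
theorem LargeDigits.exists_geodesic_itinerary (h : LargeDigits α a) {b y₀ : ℝ}
    (hb : b = digitPoint α a (highDigit J) - digitPoint α a (lowDigit J))
    (hy : y₀ = 1 - digitPoint α a (lowDigit J)) :
    ∃ L : ℝ → TwoSquareSurface b, IsGeodesic b α L ∧ StartsAtHeight b L y₀ ∧
      ∀ t, L t ∈ constituentSquare b (itinerary α a J ⌊t / Real.sqrt (1 + α ^ 2)⌋) := by
  obtain ⟨h1, h2, h3, h4⟩ := h.digitPoint_bounds J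
  have h5 := h.alpha_lt
  have h6 := h.alpha_pos
  exact (h.obeysGates_itinerary hb hy (by linarith) h1 (by linarith)).exists_geodesic
    (by linarith) (by linarith) ⟨by linarith, by linarith⟩ itinerary_zero

end Gates

theorem LargeDigits.two_mul_den_lt {α : ℝ} {a : ℕ → ℕ} (h : LargeDigits α a) {c : ℝ} (hc : 0 < c)
    {i j : ℕ} (hij : i < j) : 2 * (c * cfDen a i) < c * cfDen a j := by
  have h1 := h.den_pos i
  have h2 := h.mul_den_le i
  have h3 := h.den_mono (show i + 1 ≤ j from hij)
  have h4 : (2 * cfDen a i : ℝ) < cfDen a j := by exact_mod_cast (by omega : _ < _)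
  have := mul_lt_mul_of_pos_left h4 hc
  linarith

theorem theorem3p4 (ε : ℝ) (hε0 : 0 < ε) (hε1 : ε < 1)
    (α : ℝ) (hα0 : 0 < α) (hα1 : α < 1) (hα : Irrational α)
    -- `a i` is the digit `a_{i+1}` of the continued fraction of `α`
    (a : ℕ → ℕ) (ha : ∀ i, (GenContFract.of α).partDens.get? i = some (a i : ℝ))
    (ha_summable : Summable (fun i => 1 / (a i : ℝ)))
    (ha_sum : ∑' i, 1 / (a i : ℝ) < ε / 300) :
    (0 < gateZero α ∧ gateZero α < 1 ∧
      ∃ L₀ : ℝ → TwoSquareSurface (gateZero α),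
        IsGeodesic (gateZero α) α L₀ ∧
        StartsAtHeight (gateZero α) L₀ (startZero α) ∧
        -- (i)
        (∃ T : ℕ → ℝ,
          (∀ n, 1 ≤ n → 0 < T n ∧ 2 * T n < T (n + 1)) ∧
          (∀ C : ℕ, 0 < C → (C : ℝ) < 200 / ε → ∀ n, 1 ≤ n → ∀ b : ℕ, b ≤ C → b ≠ 1 →
            1 - ε < 1 / T n * visitTime L₀ Side.left (b * T n) ((b + 1) * T n)) ∧
          (∀ n, 1 ≤ n →
            1 - ε < 1 / T n * visitTime L₀ Side.right (T n) (2 * T n))) ∧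
        -- (ii)
        (∃ T : ℕ → ℝ,
          (∀ n, 1 ≤ n → 0 < T n ∧ 2 * T n < T (n + 1)) ∧
          (∀ C : ℕ, 0 < C → (C : ℝ) < 200 / ε → ∀ n, 1 ≤ n → ∀ b : ℕ, b ≤ C → b ≠ 2 →
            1 - ε < 1 / T n * visitTime L₀ Side.left (b * T n) ((b + 1) * T n)) ∧
          (∀ n, 1 ≤ n →
            1 - ε < 1 / T n * visitTime L₀ Side.right (2 * T n) (3 * T n)))) ∧
    ∀ n : ℕ, 1 ≤ n →
      0 < gateOne α n ∧ gateOne α n < 1 ∧ |gateOne α n - gateZero α| < ε ∧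
      ∃ L₁ : ℝ → TwoSquareSurface (gateOne α n),
        IsGeodesic (gateOne α n) α L₁ ∧
        StartsAtHeight (gateOne α n) L₁ (startOne α n) ∧
        -- (iii)
        (∃ W : ℕ → ℝ,
          (∀ i, 1 ≤ i → i ≤ n → 0 < W i) ∧
          (∀ i, 1 ≤ i → i < n → 2 * W i < W (i + 1)) ∧
          (∀ i, 1 ≤ i → i ≤ n →
            1 - ε < 1 / W i * visitTime L₁ Side.left 0 (W i) ∧
            1 - ε < 1 / W i * visitTime L₁ Side.right (W i) (2 * W i))) ∧
        -- (iv)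
        (∃ Wstar : ℝ, 0 < Wstar ∧ ∀ W : ℝ, Wstar < W →
          2 / 3 - ε < 1 / W * visitTime L₁ Side.left 0 W) := by
  set s := ∑' i, 1 / (a i : ℝ) with hsdef
  have hs : ∀ n, ∑ i ∈ Finset.range n, 1 / (a i : ℝ) ≤ s := fun n =>
    ha_summable.sum_le_tsum _ fun i _ => one_div_digit_nonneg a i
  have hlargeε : ∀ i, 300 / ε < a i := by
    intro i
    have h1 := (one_div_digit_le hs i).trans_lt ha_sum
    have h2 : (0 : ℝ) < a i := by exact_mod_cast one_le_of_partDens ha i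
    rw [div_lt_div_iff₀ h2 (by norm_num)] at h1
    rw [div_lt_iff₀ hε0]
    linarith
  have h300 : 300 < 300 / ε := by rw [lt_div_iff₀ hε0]; linarith
  have h : LargeDigits α a :=
    ⟨fun i => by exact_mod_cast h300.trans (hlargeε i), cfEta_sign hα0 hα1 ha⟩
  have heta := eta_eq_cfEta hα0 hα1 ha
  set c := Real.sqrt (1 + α ^ 2) with hcdef
  have hc : 0 < c := Real.sqrt_pos.2 (by positivity)
  have hgood : 1 - ε < 1 - 14 * s := by linarith
  have hdenR : ∀ i, (0 : ℝ) < cfDen a i := fun i => by exact_mod_cast h.den_pos i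
  have hblock : ∀ C : ℕ, (C : ℝ) < 200 / ε → ∀ b : ℕ, b ≤ C → ∀ m, (b : ℝ) + 1 ≤ a m := by
    intro C hC b hb m
    have h1 : (b : ℝ) ≤ C := by exact_mod_cast hb
    have h2 : 300 / ε = 200 / ε + 100 / ε := by ring
    have h3 : 1 < 100 / ε := by rw [lt_div_iff₀ hε0]; linarith
    linarith [hlargeε m]
  have hα3 : α < ε / 300 := by
    have h1 := h.digit_mul_alpha_lt
    have h2 := hlargeε 0
    rw [div_lt_iff₀ hε0] at h2
    have h3 := h.digit_pos 0
    rw [lt_div_iff₀ (by norm_num)]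
    by_contra hcon
    push Not at hcon
    nlinarith
  have hb0 := h.digitPoint_bounds fun _ => True
  refine ⟨⟨?_, ?_, ?_⟩, fun n _ => ⟨?_, ?_, ?_, ?_⟩⟩
  · rw [gateZero_eq h heta]; linarith
  · rw [gateZero_eq h heta]; linarith
  · obtain ⟨L, hL1, hL2, hL3⟩ := h.exists_geodesic_itinerary (gateZero_eq h heta)
      (startZero_eq heta)
    refine ⟨L, hL1, hL2, ⟨fun n => c * cfDen a (2 * n - 1), fun n hn => ⟨?_, ?_⟩, ?_, ?_⟩,
      ⟨fun n => c * cfDen a (2 * n), fun n hn => ⟨?_, ?_⟩, ?_, ?_⟩⟩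
    · exact mul_pos hc (hdenR _)
    · exact h.two_mul_den_lt hc (by omega)
    · intro C _ hC n hn b hb hb1
      have hodd : Odd (2 * n - 1) := ⟨n - 1, by omega⟩
      have := h.block_visitTime_ge hc hL3 (m := 2 * n - 1) (by omega)
        (h.resonant_of_odd hodd trivial) (by norm_num) (hblock C hC b hb _) hs rfl rfl rfl
      rw [if_neg (by exact_mod_cast hb1)] at this
      exact hgood.trans_le this
    · intro n hn
      have hodd : Odd (2 * n - 1) := ⟨n - 1, by omega⟩
      have := h.block_visitTime_ge hc hL3 (m := 2 * n - 1) (b := 1) (by omega)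
        (h.resonant_of_odd hodd trivial) (by norm_num) (by push_cast; linarith [hlargeε (2 * n - 1)])
        hs rfl (u := c * cfDen a (2 * n - 1)) (v := 2 * (c * cfDen a (2 * n - 1)))
        (by push_cast; ring) (by push_cast; ring)
      rw [if_pos (by norm_num)] at this
      exact hgood.trans_le this
    · exact mul_pos hc (hdenR _)
    · exact h.two_mul_den_lt hc (by omega)
    · intro C _ hC n hn b hb hb2
      have := h.block_visitTime_ge hc hL3 (m := 2 * n) (by omega)
        (h.resonant_of_even (by omega) (even_two_mul n)) (by norm_num) (hblock C hC b hb _)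
        hs rfl rfl rfl
      rw [if_neg (by exact_mod_cast hb2)] at this
      exact hgood.trans_le this
    · intro n hn
      have := h.block_visitTime_ge hc hL3 (m := 2 * n) (b := 2) (by omega)
        (h.resonant_of_even (by omega) (even_two_mul n)) (by norm_num)
        (by push_cast; linarith [hlargeε (2 * n)])
        hs rfl (u := 2 * (c * cfDen a (2 * n))) (v := 3 * (c * cfDen a (2 * n)))
        (by push_cast; ring) (by push_cast; ring)
      rw [if_pos (by norm_num)] at this
      exact hgood.trans_le this
  all_goals have hb1 := h.digitPoint_bounds (· < 2 * n + 2)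
  · rw [gateOne_eq h heta]; linarith
  · rw [gateOne_eq h heta]; linarith
  · rw [gateOne_eq h heta, gateZero_eq h heta, abs_lt]
    constructor <;> linarith
  · obtain ⟨L, hL1, hL2, hL3⟩ := h.exists_geodesic_itinerary (gateOne_eq h heta n)
      (startOne_eq heta n)
    refine ⟨L, hL1, hL2, ⟨fun i => c * cfDen a (2 * i - 1), fun i _ _ => mul_pos hc (hdenR _),
      fun i _ _ => h.two_mul_den_lt hc (by omega), fun i hi hin => ?_⟩,
      h.exists_visitTime_left_gt hc hε0 hε1 hL3 (n := 2 * n + 2) (fun i hi => by omega) hs ha_sum⟩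
    have hodd : Odd (2 * i - 1) := ⟨i - 1, by omega⟩
    have hres := h.resonant_of_odd (J := (· < 2 * n + 2)) hodd (by omega)
    constructor
    · have := h.block_visitTime_ge hc hL3 (m := 2 * i - 1) (b := 0) (by omega) hres (by norm_num)
        (by push_cast; linarith [hlargeε (2 * i - 1)])
        hs rfl (u := 0) (v := c * cfDen a (2 * i - 1)) (by push_cast; ring) (by push_cast; ring)
      rw [if_neg (by norm_num)] at this
      exact hgood.trans_le this
    · have := h.block_visitTime_ge hc hL3 (m := 2 * i - 1) (b := 1) (by omega) hres (by norm_num)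
        (by push_cast; linarith [hlargeε (2 * i - 1)])
        hs rfl (u := c * cfDen a (2 * i - 1)) (v := 2 * (c * cfDen a (2 * i - 1)))
        (by push_cast; ring) (by push_cast; ring)
      rw [if_pos (by norm_num)] at this
      exact hgood.trans_le this
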